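/- Let $X$ be a real Banach space and $\Omega\subsetneq X$ a convex domain (a nonempty open convex set). Write $d(z)=\operatorname{dist}(z,\partial\Omega)$ and, for $x,y\in\Omega$, $$k(x,y)=\inf_\gamma\int_\gamma\frac{|dz|}{d(z)},\qquad j(x,y)=\log\Bigl(1+\frac{\|x-y\|}{\min\{d(x),d(y)\}}\Bigr),$$ where the infimum is over all rectifiable paths $\gamma$ in $\Omega$ from $x$ to $y$ and $|dz|$ is arc length in the norm. For $m\in\{k,j\}$, $x\in\Omega$, $r>0$ let $B_m(x,r)=\{y\in\Omega: m(x,y)<r\}$ (the quasihyperbolic ball for $m=k$, the $j$-ball for $m=j$). An open set $G\subset X$ is called *strictly convex* if for every $x\in G$ it is starlike with respect to $x$ and every half-line $\{x+tv:t\ge 0\}$, $v\neq 0$, meets $\partial G$ in exactly one point. The domain $\Omega$ is *uniformly convex* if for every $\varepsilon>0$ there is $\delta>0$ such that $a,b\in\Omega$, $\|a-b\|\ge\varepsilon$ imply that the ball of radius $\delta$ about $(a+b)/2$ lies in $\Omega$. The space $X$ is strictly convex if its unit sphere contains no nondegenerate segment, and it has the Radon–Nikodym property (RNP) if every Lipschitz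 path $[0,1]\to X$ is differentiable almost everywhere. Then: 1. For all $x\in\Omega$ and $r>0$ the balls $B_k(x,r)$ and $B_j(x,r)$ are convex. 2. If $\Omega$ is uniformly convex, or if $X$ is strictly convex and has the RNP, then all the balls $B_k(x,r)$ and $B_j(x,r)$ are strictly convex. 3. Strict convexity holds also in the sense that, for any two distinct points of the closure of the ball, the open segment between them lies in the interior of that closure: for all $B_k(x,r)$ if $\Omega$ is uniformly convex, and for all $B_j(x,r)$ if $X$ is strictly convex. -/

import Mathlib

open Set MeasureTheory

noncomputable section

section QuasihyperbolicDefs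

variable {X : Type*} [NormedAddCommGroup X] [NormedSpace ℝ X]

/-- `γ : [0,1] → Ω` is a rectifiable path (continuous, of finite length) in `Ω` from `x` to `y`.
Values of `γ` outside `[0,1]` play no role. -/
structure IsRectifiablePath (Ω : Set X) (γ : ℝ → X) (x y : X) : Prop where
  continuousOn : ContinuousOn γ (Icc 0 1)
  rectifiable : BoundedVariationOn γ (Icc 0 1)
  mapsTo : MapsTo γ (Icc 0 1) Ω
  source : γ 0 = x
  target : γ 1 = y

/-- The norm length of a path on `[0,1]` (the total variation). -/
def pathLength (γ : ℝ → X) : ℝ := (eVariationOn γ (Icc 0 1)).toReal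

/-- Quasihyperbolic length `∫_γ |dz| / d(z, ∂Ω)` of a rectifiable path on `[0,1]`: the line
integral with respect to arc length, computed along the arc-length parametrization. -/
def quasihyperbolicLength (Ω : Set X) (γ : ℝ → X) : ℝ :=
  ∫ s in (0 : ℝ)..(pathLength γ),
    1 / Metric.infDist (naturalParameterization γ (Icc 0 1) 0 s) (frontier Ω)

/-- Quasihyperbolic metric: infimum of the quasihyperbolic lengths of all rectifiable paths
in `Ω` joining the two points. -/
def quasihyperbolicDist (Ω : Set X) (x y : X) : ℝ :=
  sInf {l : ℝ | ∃ γ : ℝ → X, IsRectifiablePath Ω γ x y ∧ l = quasihyperbolicLength Ω γ}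

/-- Distance ratio metric. -/
def distanceRatioDist (Ω : Set X) (x y : X) : ℝ :=
  Real.log (1 + ‖x - y‖ /
    min (Metric.infDist x (frontier Ω)) (Metric.infDist y (frontier Ω)))

/-- Open quasihyperbolic ball. -/
def quasihyperbolicBall (Ω : Set X) (x : X) (r : ℝ) : Set X :=
  {y | y ∈ Ω ∧ quasihyperbolicDist Ω x y < r}

/-- Open `j`-ball. -/
def jBall (Ω : Set X) (x : X) (r : ℝ) : Set X :=
  {y | y ∈ Ω ∧ distanceRatioDist Ω x y < r}

/-- `G` is strictly starlike with respect to `x`: it is starlike with respect to `x`, and each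
half-line `{x + t v : t ≥ 0}`, `v ≠ 0`, meets the boundary of `G` at exactly one point. -/
def IsStrictlyStarlike (G : Set X) (x : X) : Prop :=
  StarConvex ℝ x G ∧ ∀ v : X, v ≠ 0 → ∃! t : ℝ, 0 ≤ t ∧ x + t • v ∈ frontier G

/-- `G` is a strictly convex open set: it is strictly starlike with respect to each of its
points. (For the absence of segments in the boundary see `StrictConvex ℝ (closure G)`.) -/
def IsStrictlyConvexOpen (G : Set X) : Prop :=
  IsOpen G ∧ ∀ x ∈ G, IsStrictlyStarlike G x

/-- Uniformly convex set: for all `ε > 0` there is `δ > 0` such that the midpoint of any two of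
its points at distance at least `ε` is the centre of a ball of radius `δ` inside the set. The
open unit ball is uniformly convex in this sense iff the space is uniformly convex. -/
def IsUniformlyConvexSet (G : Set X) : Prop :=
  ∀ ε : ℝ, 0 < ε → ∃ δ : ℝ, 0 < δ ∧ ∀ a ∈ G, ∀ b ∈ G, ε ≤ ‖a - b‖ →
    Metric.ball (midpoint ℝ a b) δ ⊆ G

variable (X) in
/-- Radon–Nikodym property, for a real Banach space: every Lipschitz path `[0,1] → X` is
differentiable almost everywhere. -/
def HasRNP : Prop :=
  ∀ (γ : ℝ → X) (K : NNReal), LipschitzOnWith K γ (Icc 0 1) →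
    ∀ᵐ t ∂(volume.restrict (Icc (0 : ℝ) 1)), DifferentiableAt ℝ γ t

end QuasihyperbolicDefs

end

/-! On a convex domain the distance d to the boundary is concave, and the convexity claims are
averaging arguments resting on this. Quasihyperbolic distance is handled through paths with ‖γ t - γ
s‖ ≤ ∫ d(γ) over [s, t] (`IsQHPath`): by `quasihyperbolicDist_lt_iff`, k(x, y) < r exactly when such
a path joins x to y in some time T < r. The condition is integral, so paths are never
differentiated. Two such paths of equal duration average to a third (`IsQHPath.average`), because d
is concave; hence k-balls are convex. A j-ball is cut out of Ω by bounding the convex function ‖x -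
y‖ of y by a constant and by (exp r - 1) d(y), which is concave.

Both kinds of ball are bounded, and a bounded open convex set is strictly starlike about each of its
points (`IsStrictlyConvexOpen.of_isBounded`).

For the closures it suffices to put midpoints of distinct points y, z into the ball. In the k-case y
and z are reached from x in every time T > r, so the averaged path must save an amount of time that
does not depend on T. If d(y) < d(z), the saving comes from desynchronizing the two paths: averaging
pieces of durations τ and τ' costs a mean of τ and τ' weighted by the values of d, so the second
path gets extra time near x, where the weights are almost equal, and gives it back near z, where its
weight is larger. If d(y) = d(z), uniform convexity makes d at midpoints near the end exceed the
mean by a fixed amount. In the j-case the strict triangle inequality applies, except when y and z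
lie on one ray from x; there concavity of d and d(x) > 0 suffice. -/

theorem IsPreconnected.inter_frontier_nonempty {α : Type*} [TopologicalSpace α] {s u : Set α}
    (hs : IsPreconnected s) (h1 : (s ∩ u).Nonempty) (h2 : (s ∩ uᶜ).Nonempty) :
    (s ∩ frontier u).Nonempty := by
  by_contra hcon
  rw [not_nonempty_iff_eq_empty] at hcon
  have hcon' : ∀ p ∈ s, p ∈ closure u → p ∈ interior u := fun p hp hpc => by
    by_contra hpi
    exact (hcon ▸ ⟨hp, hpc, hpi⟩ : p ∈ (∅ : Set α))
  obtain ⟨a, has, hau⟩ := h1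
  obtain ⟨b, hbs, hbu⟩ := h2
  obtain ⟨c, -, hc1, hc2⟩ := hs (interior u) (closure u)ᶜ isOpen_interior
    isClosed_closure.isOpen_compl
    (fun p hp => (em (p ∈ closure u)).imp (hcon' p hp) id) ⟨a, has, hcon' a has (subset_closure hau)⟩
    ⟨b, hbs, fun h => hbu (interior_subset (hcon' b hbs h))⟩
  exact hc2 (interior_subset_closure hc1)

/-- A nonempty proper open convex subset of a normed space. -/
structure IsConvexDomain {X : Type*} [NormedAddCommGroup X] [NormedSpace ℝ X] (Ω : Set X) :
    Prop where
  isOpen : IsOpen Ω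
  nonempty : Ω.Nonempty
  convex : Convex ℝ Ω
  ne_univ : Ω ≠ univ

/-- Distance to the boundary. -/
noncomputable abbrev boundaryDist {X : Type*} [NormedAddCommGroup X] (Ω : Set X) (z : X) : ℝ :=
  Metric.infDist z (frontier Ω)

/-! ### Concavity of the boundary distance -/

namespace IsConvexDomain

variable {X : Type*} [NormedAddCommGroup X] [NormedSpace ℝ X] {Ω : Set X} {x y : X}

theorem frontier_nonempty (hΩ : IsConvexDomain Ω) : (frontier Ω).Nonempty :=
  nonempty_frontier_iff.2 ⟨hΩ.nonempty, hΩ.ne_univ⟩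

theorem notMem_frontier (hΩ : IsConvexDomain Ω) (hx : x ∈ Ω) : x ∉ frontier Ω := by
  rw [hΩ.isOpen.frontier_eq]
  exact fun h => h.2 hx

theorem boundaryDist_pos (hΩ : IsConvexDomain Ω) (hx : x ∈ Ω) : 0 < boundaryDist Ω x :=
  (isClosed_frontier.notMem_iff_infDist_pos hΩ.frontier_nonempty).1 (hΩ.notMem_frontier hx)

/-- A ball is connected, so one that leaves Ω meets the boundary, at a distance from x smaller than
its radius. -/
theorem ball_subset (hΩ : IsConvexDomain Ω) (hx : x ∈ Ω) :
    Metric.ball x (boundaryDist Ω x) ⊆ Ω := by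
  by_contra h
  obtain ⟨z, hz, hzΩ⟩ := not_subset.1 h
  obtain ⟨p, hp, hpf⟩ := (convex_ball x (boundaryDist Ω x)).isPreconnected.inter_frontier_nonempty
    ⟨x, Metric.mem_ball_self (hΩ.boundaryDist_pos hx), hx⟩ ⟨z, hz, hzΩ⟩
  have := Metric.infDist_le_dist_of_mem (x := x) hpf
  rw [Metric.mem_ball, dist_comm] at hp
  exact absurd hp (not_lt.2 this)

theorem le_boundaryDist (hΩ : IsConvexDomain Ω) {ρ : ℝ} (h : Metric.ball x ρ ⊆ Ω) :
    ρ ≤ boundaryDist Ω x := by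
  refine (Metric.le_infDist hΩ.frontier_nonempty).2 fun p hp => ?_
  by_contra hlt
  push Not at hlt
  exact hΩ.notMem_frontier (h (by rwa [Metric.mem_ball, dist_comm])) hp

theorem mem_of_mem_closure (hΩ : IsConvexDomain Ω) (hx : x ∈ closure Ω)
    (h : 0 < boundaryDist Ω x) : x ∈ Ω := by
  by_contra hxΩ
  have : x ∈ frontier Ω := by
    rw [hΩ.isOpen.frontier_eq]
    exact ⟨hx, hxΩ⟩
  exact h.ne' (Metric.infDist_zero_of_mem this)

/-- For ‖u‖ < 1 both x + d(x) u and y + d(y) u lie in Ω. Their convex combinations, as u varies,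
fill the ball of radius a d(x) + b d(y) about a x + b y. -/
theorem concaveOn_boundaryDist (hΩ : IsConvexDomain Ω) : ConcaveOn ℝ Ω (boundaryDist Ω) := by
  refine ⟨hΩ.convex, fun x hx y hy a b ha hb hab => hΩ.le_boundaryDist fun z hz => ?_⟩
  have hdx := hΩ.boundaryDist_pos hx
  have hdy := hΩ.boundaryDist_pos hy
  simp only [smul_eq_mul] at hz
  set R := a * boundaryDist Ω x + b * boundaryDist Ω y with hR
  have hRpos : 0 < R := by
    rcases eq_or_lt_of_le ha with h | h
    · have : b = 1 := by linarith
      simp only [hR, ← h, this]; linarith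
    · have := mul_pos h hdx
      have := mul_nonneg hb hdy.le
      linarith
  set u := R⁻¹ • (z - (a • x + b • y)) with hu
  have hu1 : ‖u‖ < 1 := by
    rw [hu, norm_smul, norm_inv, Real.norm_of_nonneg hRpos.le, inv_mul_lt_iff₀ hRpos, mul_one,
      ← dist_eq_norm]
    exact hz
  have key : ∀ w ∈ Ω, w + boundaryDist Ω w • u ∈ Ω := by
    intro w hw
    have hdw := hΩ.boundaryDist_pos hw
    apply hΩ.ball_subset hw
    rw [Metric.mem_ball, dist_eq_norm, add_sub_cancel_left, norm_smul, Real.norm_of_nonneg hdw.le]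
    exact mul_lt_of_lt_one_right hdw hu1
  have hz' : z = a • (x + boundaryDist Ω x • u) + b • (y + boundaryDist Ω y • u) := by
    have h1 : z - (a • x + b • y) = R • u := by rw [hu, smul_inv_smul₀ hRpos.ne']
    rw [sub_eq_iff_eq_add.1 h1, hR, add_smul, mul_smul, mul_smul, smul_add, smul_add]
    abel
  rw [hz']
  exact hΩ.convex (key x hx) (key y hy) ha hb hab

end IsConvexDomain

theorem abs_boundaryDist_sub_le {X : Type*} [NormedAddCommGroup X] (Ω : Set X) (x y : X) :
    |boundaryDist Ω x - boundaryDist Ω y| ≤ ‖x - y‖ := by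
  have := (Metric.lipschitz_infDist_pt (frontier Ω)).dist_le_mul x y
  rwa [NNReal.coe_one, one_mul, Real.dist_eq, dist_eq_norm] at this

/-- The path `γ`, restricted to `[0, T]`, has quasihyperbolic speed at most one: the norm speed at
each time is at most the distance to the boundary. -/
structure IsQHPath {X : Type*} [NormedAddCommGroup X] (Ω : Set X) (γ : ℝ → X)
    (T : ℝ) : Prop where
  continuous : Continuous γ
  mem : ∀ t, γ t ∈ Ω
  speed : ∀ s t, 0 ≤ s → s ≤ t → t ≤ T → ‖γ t - γ s‖ ≤ ∫ u in s..t, boundaryDist Ω (γ u)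

/-! ### Paths of quasihyperbolic speed at most one -/

namespace IsQHPath

variable {X : Type*} [NormedAddCommGroup X] {Ω : Set X} {γ : ℝ → X} {T : ℝ}

theorem continuous_boundaryDist (h : IsQHPath Ω γ T) :
    Continuous fun t => boundaryDist Ω (γ t) :=
  (Metric.continuous_infDist_pt _).comp h.continuous

theorem intervalIntegrable (h : IsQHPath Ω γ T) (a b : ℝ) :
    IntervalIntegrable (fun t => boundaryDist Ω (γ t)) volume a b :=
  h.continuous_boundaryDist.intervalIntegrable a b

theorem mono (h : IsQHPath Ω γ T) {T' : ℝ} (hT : T' ≤ T) : IsQHPath Ω γ T' :=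
  ⟨h.continuous, h.mem, fun s t hs hst ht => h.speed s t hs hst (ht.trans hT)⟩

theorem shift (h : IsQHPath Ω γ T) {a : ℝ} (ha : 0 ≤ a) :
    IsQHPath Ω (fun t => γ (a + t)) (T - a) := by
  refine ⟨h.continuous.comp (continuous_const.add continuous_id), fun t => h.mem _,
    fun s t hs hst ht => ?_⟩
  have := h.speed (a + s) (a + t) (by linarith) (by linarith) (by linarith)
  rwa [intervalIntegral.integral_comp_add_left (fun u => boundaryDist Ω (γ u))]

theorem reverse (h : IsQHPath Ω γ T) : IsQHPath Ω (fun t => γ (T - t)) T := by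
  refine ⟨h.continuous.comp (continuous_const.sub continuous_id), fun t => h.mem _,
    fun s t hs hst ht => ?_⟩
  have := h.speed (T - t) (T - s) (by linarith) (by linarith) (by linarith)
  rwa [intervalIntegral.integral_comp_sub_left (fun u => boundaryDist Ω (γ u)), norm_sub_rev]

/-- Speed is bounded only from above, so the path may wait at its endpoint. -/
theorem extend (h : IsQHPath Ω γ T) (T' : ℝ) : IsQHPath Ω (fun t => γ (min t T)) T' := by
  have hc : Continuous fun t => γ (min t T) :=
    h.continuous.comp (continuous_id.min continuous_const)
  refine ⟨hc, fun t => h.mem _, fun s t hs hst ht => ?_⟩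
  have hd : Continuous fun t => boundaryDist Ω (γ (min t T)) :=
    (Metric.continuous_infDist_pt _).comp hc
  rcases le_total s T with hsT | hsT
  · have h1 := h.speed s (min t T) hs (le_min hst hsT) (min_le_right _ _)
    have h2 : ∫ u in s..(min t T), boundaryDist Ω (γ u)
        = ∫ u in s..(min t T), boundaryDist Ω (γ (min u T)) := by
      refine intervalIntegral.integral_congr fun u hu => ?_
      rw [uIcc_of_le (le_min hst hsT)] at hu
      simp only [min_eq_left (hu.2.trans (min_le_right _ _))]
    rw [min_eq_left hsT]
    refine (h1.trans_eq h2).trans ?_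
    rw [← intervalIntegral.integral_add_adjacent_intervals (hd.intervalIntegrable s (min t T))
      (hd.intervalIntegrable (min t T) t)]
    exact le_add_of_nonneg_right (intervalIntegral.integral_nonneg (min_le_left _ _)
      fun u _ => Metric.infDist_nonneg)
  · rw [min_eq_right hsT, min_eq_right (hsT.trans hst), sub_self, norm_zero]
    exact intervalIntegral.integral_nonneg hst fun u _ => Metric.infDist_nonneg

theorem trans (h : IsQHPath Ω γ T) {δ : ℝ → X} {S : ℝ} (h' : IsQHPath Ω δ S)
    (hδ : δ 0 = γ T) :
    IsQHPath Ω (fun t => if t ≤ T then γ t else δ (t - T)) (T + S) := by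
  have hc : Continuous fun t => if t ≤ T then γ t else δ (t - T) := by
    refine Continuous.if_le h.continuous
      (h'.continuous.comp (continuous_id.sub continuous_const)) continuous_id
      continuous_const ?_
    rintro t rfl
    simp [hδ]
  have hd : Continuous fun t => boundaryDist Ω (if t ≤ T then γ t else δ (t - T)) :=
    (Metric.continuous_infDist_pt _).comp hc
  have hright : ∀ t, T ≤ t → (if t ≤ T then γ t else δ (t - T)) = δ (t - T) := by
    intro t ht
    split_ifs with h1
    · have : t = T := le_antisymm h1 ht
      simp [this, hδ]
    · rfl
  have A : ∀ s t, 0 ≤ s → s ≤ t → t ≤ T →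
      ‖(if t ≤ T then γ t else δ (t - T)) - (if s ≤ T then γ s else δ (s - T))‖ ≤
        ∫ u in s..t, boundaryDist Ω (if u ≤ T then γ u else δ (u - T)) := by
    intro s t hs hst ht
    rw [if_pos ht, if_pos (hst.trans ht)]
    refine (h.speed s t hs hst ht).trans_eq (intervalIntegral.integral_congr fun u hu => ?_)
    rw [uIcc_of_le hst] at hu
    simp only [if_pos (hu.2.trans ht)]
  have B : ∀ s t, T ≤ s → s ≤ t → t ≤ T + S →
      ‖(if t ≤ T then γ t else δ (t - T)) - (if s ≤ T then γ s else δ (s - T))‖ ≤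
        ∫ u in s..t, boundaryDist Ω (if u ≤ T then γ u else δ (u - T)) := by
    intro s t hs hst ht
    rw [hright t (hs.trans hst), hright s hs]
    have := h'.speed (s - T) (t - T) (by linarith) (by linarith) (by linarith)
    rw [← intervalIntegral.integral_comp_sub_right (fun u => boundaryDist Ω (δ u))] at this
    refine this.trans_eq (intervalIntegral.integral_congr fun u hu => ?_)
    rw [uIcc_of_le hst] at hu
    simp only [hright u (hs.trans hu.1)]
  refine ⟨hc, fun t => ?_, fun s t hs hst ht => ?_⟩
  · split_ifs
    · exact h.mem _
    · exact h'.mem _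
  rcases le_total t T with htT | htT
  · exact A s t hs hst htT
  rcases le_total T s with hsT | hsT
  · exact B s t hsT hst ht
  have h1 := A s T hs hsT le_rfl
  have h2 := B T t le_rfl htT ht
  rw [← intervalIntegral.integral_add_adjacent_intervals (hd.intervalIntegrable s T)
      (hd.intervalIntegrable T t)]
  refine le_trans ?_ (add_le_add h2 h1 |>.trans_eq (add_comm _ _))
  exact norm_sub_le_norm_sub_add_norm_sub _ _ _

/-- Grönwall's argument: d is 1-Lipschitz, so d(γ u) is at most d(γ s) plus the integral of d(γ)
over [s, u], and this bound divided by exp (u - s) is nonincreasing. -/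
theorem boundaryDist_le (h : IsQHPath Ω γ T) {s t : ℝ} (hs : 0 ≤ s) (hst : s ≤ t) (ht : t ≤ T) :
    boundaryDist Ω (γ t) ≤ boundaryDist Ω (γ s) * Real.exp (t - s) := by
  set f : ℝ → ℝ := fun u => boundaryDist Ω (γ u) with hf
  have hfc : Continuous f := h.continuous_boundaryDist
  set F : ℝ → ℝ := fun u => (f s + ∫ v in s..u, f v) * Real.exp (-(u - s)) with hF
  have hle : ∀ u, s ≤ u → u ≤ t → f u ≤ f s + ∫ v in s..u, f v := by
    intro u hsu hut
    have h1 := h.speed s u hs hsu (hut.trans ht)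
    have h2 := (abs_le.1 (abs_boundaryDist_sub_le Ω (γ u) (γ s))).2
    simp only [hf]
    linarith
  have hder : ∀ u, HasDerivAt F
      (f u * Real.exp (-(u - s)) + (f s + ∫ v in s..u, f v) * (Real.exp (-(u - s)) * (-1))) u := by
    intro u
    have h1 : HasDerivAt (fun u => f s + ∫ v in s..u, f v) (f u) u :=
      (intervalIntegral.integral_hasDerivAt_right (hfc.intervalIntegrable _ _)
        (hfc.stronglyMeasurableAtFilter _ _) hfc.continuousAt).const_add _
    have h2 : HasDerivAt (fun u => Real.exp (-(u - s))) (Real.exp (-(u - s)) * (-1)) u :=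
      (((hasDerivAt_id u).sub_const s).neg).exp
    exact h1.mul h2
  have hanti : AntitoneOn F (Icc s t) := by
    refine antitoneOn_of_deriv_nonpos (convex_Icc _ _)
      (fun u _ => (hder u).continuousAt.continuousWithinAt)
      (fun u _ => (hder u).differentiableAt.differentiableWithinAt) fun u hu => ?_
    rw [interior_Icc] at hu
    rw [(hder u).deriv]
    have := hle u hu.1.le hu.2.le
    nlinarith [Real.exp_pos (-(u - s))]
  have h3 := hanti (left_mem_Icc.2 hst) (right_mem_Icc.2 hst) hst
  simp only [hF, sub_self, neg_zero, Real.exp_zero, mul_one, intervalIntegral.integral_same,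
    add_zero] at h3
  rw [Real.exp_neg, ← div_eq_mul_inv, div_le_iff₀ (Real.exp_pos _)] at h3
  exact (hle t hst le_rfl).trans h3

theorem le_boundaryDist (h : IsQHPath Ω γ T) {s t : ℝ} (hs : 0 ≤ s) (hst : s ≤ t) (ht : t ≤ T) :
    boundaryDist Ω (γ s) ≤ boundaryDist Ω (γ t) * Real.exp (t - s) := by
  have := h.reverse.boundaryDist_le (s := T - t) (t := T - s) (by linarith) (by linarith)
    (by linarith)
  simpa using this

theorem norm_sub_le (h : IsQHPath Ω γ T) {s t : ℝ} (hs : 0 ≤ s) (hst : s ≤ t) (ht : t ≤ T) :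
    ‖γ t - γ s‖ ≤ boundaryDist Ω (γ s) * (Real.exp (t - s) - 1) := by
  refine (h.speed s t hs hst ht).trans ?_
  have hg : Continuous fun u => boundaryDist Ω (γ s) * Real.exp (u - s) := by fun_prop
  refine (intervalIntegral.integral_mono_on hst (h.intervalIntegrable _ _)
    (hg.intervalIntegrable _ _) fun u hu => h.boundaryDist_le hs hu.1 (hu.2.trans ht)).trans ?_
  rw [intervalIntegral.integral_const_mul,
    intervalIntegral.integral_comp_sub_right (fun u => Real.exp u), integral_exp]
  simp

variable [NormedSpace ℝ X]

/-- Averaging two paths run at constant multiples of their speeds. -/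
theorem average (hΩ : IsConvexDomain Ω) {δ : ℝ → X} {S M a b : ℝ} (hT : 0 ≤ T) (hS : 0 ≤ S)
    (h : IsQHPath Ω γ T) (h' : IsQHPath Ω δ S) (hM : 0 < M) (ha : 0 ≤ a) (hb : 0 ≤ b)
    (hab : a + b = 1)
    (hineq : ∀ t, 0 ≤ t → t ≤ 1 →
      a * (T * boundaryDist Ω (γ (T * t))) + b * (S * boundaryDist Ω (δ (S * t))) ≤
        M * boundaryDist Ω (a • γ (T * t) + b • δ (S * t))) :
    IsQHPath Ω (fun t => a • γ (T * (t / M)) + b • δ (S * (t / M))) M := by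
  have hc : Continuous fun t => a • γ (T * (t / M)) + b • δ (S * (t / M)) := by
    have h1 := h.continuous
    have h2 := h'.continuous
    fun_prop
  have hd : Continuous fun t => boundaryDist Ω (a • γ (T * (t / M)) + b • δ (S * (t / M))) :=
    (Metric.continuous_infDist_pt _).comp hc
  -- Linear time change: a path of duration T run in time M has its speed multiplied by T / M.
  have speed' : ∀ {γ : ℝ → X} {T : ℝ}, 0 ≤ T → IsQHPath Ω γ T → ∀ s t, 0 ≤ s → s ≤ t → t ≤ M →
      ‖γ (T * (t / M)) - γ (T * (s / M))‖ ≤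
        ∫ u in s..t, T / M * boundaryDist Ω (γ (T * (u / M))) := by
    intro γ T hT h s t hs hst ht
    have h0 := h.speed (T * (s / M)) (T * (t / M)) (by positivity) (by gcongr)
      (mul_le_of_le_one_right hT ((div_le_one hM).2 ht))
    refine h0.trans_eq ?_
    rw [intervalIntegral.integral_const_mul]
    have := intervalIntegral.mul_integral_comp_mul_left (a := s) (b := t)
      (f := fun u => boundaryDist Ω (γ u)) (c := T / M)
    simp only [div_mul_eq_mul_div, mul_div_assoc] at this ⊢
    exact this.symm
  refine ⟨hc, fun t => hΩ.convex (h.mem _) (h'.mem _) ha hb hab, fun s t hs hst ht => ?_⟩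
  have e1 := speed' hT h s t hs hst ht
  have e2 := speed' hS h' s t hs hst ht
  have c1 : Continuous fun u => T / M * boundaryDist Ω (γ (T * (u / M))) := by
    have := h.continuous_boundaryDist
    exact continuous_const.mul (this.comp (by fun_prop))
  have c2 : Continuous fun u => S / M * boundaryDist Ω (δ (S * (u / M))) := by
    have := h'.continuous_boundaryDist
    exact continuous_const.mul (this.comp (by fun_prop))
  calc _ = ‖a • (γ (T * (t / M)) - γ (T * (s / M))) + b • (δ (S * (t / M)) - δ (S * (s / M)))‖ := by
        congr 1
        rw [smul_sub, smul_sub]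
        abel
    _ ≤ a * ‖γ (T * (t / M)) - γ (T * (s / M))‖ + b * ‖δ (S * (t / M)) - δ (S * (s / M))‖ := by
        refine (norm_add_le _ _).trans_eq ?_
        rw [norm_smul, norm_smul, Real.norm_of_nonneg ha, Real.norm_of_nonneg hb]
    _ ≤ a * (∫ u in s..t, T / M * boundaryDist Ω (γ (T * (u / M)))) +
          b * ∫ u in s..t, S / M * boundaryDist Ω (δ (S * (u / M))) := by gcongr
    _ = ∫ u in s..t, (a * (T / M * boundaryDist Ω (γ (T * (u / M)))) +
          b * (S / M * boundaryDist Ω (δ (S * (u / M))))) := by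
        rw [intervalIntegral.integral_add ((c1.intervalIntegrable _ _).const_mul a)
          ((c2.intervalIntegrable _ _).const_mul b)]
        simp only [intervalIntegral.integral_const_mul]
    _ ≤ _ := by
        refine intervalIntegral.integral_mono_on hst
          (((continuous_const.mul c1).add (continuous_const.mul c2)).intervalIntegrable _ _)
          (hd.intervalIntegrable _ _) fun u hu => ?_
        have := hineq (u / M) (div_nonneg (hs.trans hu.1) hM.le)
          ((div_le_one hM).2 (hu.2.trans ht))
        rw [← div_le_iff₀' hM] at this
        refine le_of_eq_of_le ?_ this
        field_simp

end IsQHPath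

namespace IsConvexDomain

variable {X : Type*} [NormedAddCommGroup X] [NormedSpace ℝ X] {Ω : Set X} {x y : X}

theorem min_boundaryDist_le (hΩ : IsConvexDomain Ω) (hx : x ∈ Ω) (hy : y ∈ Ω) {t : ℝ}
    (ht : t ∈ Icc (0 : ℝ) 1) :
    min (boundaryDist Ω x) (boundaryDist Ω y) ≤ boundaryDist Ω (AffineMap.lineMap x y t) :=
  hΩ.concaveOn_boundaryDist.ge_on_segment hx hy
    (segment_eq_image_lineMap ℝ x y ▸ mem_image_of_mem _ ht)

/-- By concavity d is at least the smaller endpoint value m along the segment, so constant norm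
speed m is admissible. -/
theorem exists_isQHPath_segment (hΩ : IsConvexDomain Ω) (hx : x ∈ Ω) (hy : y ∈ Ω) :
    ∃ γ, IsQHPath Ω γ (‖x - y‖ / min (boundaryDist Ω x) (boundaryDist Ω y)) ∧ γ 0 = x ∧
      γ (‖x - y‖ / min (boundaryDist Ω x) (boundaryDist Ω y)) = y := by
  rcases eq_or_ne x y with rfl | hxy
  · refine ⟨fun _ => x, ⟨continuous_const, fun _ => hx, fun s t _ hst _ => ?_⟩, rfl, rfl⟩
    rw [sub_self, norm_zero]
    exact intervalIntegral.integral_nonneg hst fun u _ => Metric.infDist_nonneg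
  set m := min (boundaryDist Ω x) (boundaryDist Ω y) with hm
  have hmpos : 0 < m := lt_min (hΩ.boundaryDist_pos hx) (hΩ.boundaryDist_pos hy)
  have hxy' : 0 < ‖x - y‖ := norm_pos_iff.2 (sub_ne_zero.2 hxy)
  set T := ‖x - y‖ / m with hT
  have hTpos : 0 < T := div_pos hxy' hmpos
  have hc : Continuous fun t => AffineMap.lineMap x y (projIcc (0 : ℝ) 1 zero_le_one (t / T) : ℝ) :=
    AffineMap.lineMap_continuous.comp (continuous_subtype_val.comp
      (continuous_projIcc.comp (by fun_prop)))
  have hin : ∀ t, 0 ≤ t → t ≤ T → (projIcc (0 : ℝ) 1 zero_le_one (t / T) : ℝ) = t / T := by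
    intro t h0 h1
    rw [projIcc_of_mem zero_le_one ⟨div_nonneg h0 hTpos.le, (div_le_one hTpos).2 h1⟩]
  refine ⟨fun t => AffineMap.lineMap x y (projIcc (0 : ℝ) 1 zero_le_one (t / T) : ℝ),
    ⟨hc, fun t => ?_, fun s t hs hst ht => ?_⟩, ?_, ?_⟩
  · exact hΩ.convex.segment_subset hx hy
      (segment_eq_image_lineMap ℝ x y ▸ mem_image_of_mem _ (Subtype.coe_prop _))
  · have hd := (Metric.continuous_infDist_pt (frontier Ω)).comp hc
    have h1 : (t - s) * m ≤ ∫ u in s..t, boundaryDist Ω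
        (AffineMap.lineMap x y (projIcc (0 : ℝ) 1 zero_le_one (u / T) : ℝ)) := by
      rw [← smul_eq_mul, ← intervalIntegral.integral_const]
      exact intervalIntegral.integral_mono_on hst (by simp) (hd.intervalIntegrable _ _)
        fun u _ => hΩ.min_boundaryDist_le hx hy (Subtype.coe_prop _)
    refine le_trans (le_of_eq ?_) h1
    rw [hin t (hs.trans hst) ht, hin s hs (hst.trans ht), ← dist_eq_norm, dist_lineMap_lineMap,
      dist_eq_norm, dist_eq_norm, Real.norm_eq_abs, ← sub_div, abs_of_nonneg (div_nonneg (by linarith) hTpos.le), hT]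
    field_simp
  · simp
  · simp [hTpos.ne']

end IsConvexDomain

/-! ### Variation and arc-length parametrization -/

section Variation

open Filter Topology

variable {X : Type*} [NormedAddCommGroup X] {γ : ℝ → X}

theorem ContinuousOn.variationOnFromTo {s : Set ℝ} {a : ℝ} (hc : ContinuousOn γ s)
    (hb : BoundedVariationOn γ s) (ha : a ∈ s) : ContinuousOn (variationOnFromTo γ s a) s := by
  intro t ht
  have h1 := hb.tendsto_eVariationOn_Icc_zero_right t ((hc t ht).mono inter_subset_left)
  have h2 := hb.tendsto_eVariationOn_Icc_zero_left ((hc t ht).mono inter_subset_left)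
  have h3 := ((ENNReal.tendsto_toReal ENNReal.zero_ne_top).comp h1).add
    ((ENNReal.tendsto_toReal ENNReal.zero_ne_top).comp h2)
  simp only [ENNReal.toReal_zero, add_zero] at h3
  -- By additivity only the variation between t and a nearby y matters; on either side it is
  -- dominated by the sum of the two one-sided variations, which tends to 0.
  have h4 : Tendsto (_root_.variationOnFromTo γ s t) (𝓝[s] t) (𝓝 0) := by
    refine squeeze_zero_norm (fun y => ?_) h3
    simp only [Function.comp_apply, Real.norm_eq_abs, _root_.variationOnFromTo]
    split_ifs
    · rw [abs_of_nonneg ENNReal.toReal_nonneg]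
      exact le_add_of_nonneg_right ENNReal.toReal_nonneg
    · rw [abs_neg, abs_of_nonneg ENNReal.toReal_nonneg]
      exact le_add_of_nonneg_left ENNReal.toReal_nonneg
  have h5 : Tendsto (fun y => _root_.variationOnFromTo γ s a t + _root_.variationOnFromTo γ s t y)
      (𝓝[s] t) (𝓝 (_root_.variationOnFromTo γ s a t)) := by simpa using h4.const_add _
  refine h5.congr' ?_
  filter_upwards [self_mem_nhdsWithin] with y hy
  exact variationOnFromTo.add hb.locallyBoundedVariationOn ha ht hy

theorem variationOnFromTo_zero_one : variationOnFromTo γ (Icc 0 1) 0 1 = pathLength γ := by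
  rw [variationOnFromTo.eq_of_le _ _ zero_le_one, inter_self, pathLength]

theorem naturalParameterization_variationOnFromTo {s : Set ℝ} {a t : ℝ}
    (hb : BoundedVariationOn γ s) (ha : a ∈ s) (ht : t ∈ s) :
    naturalParameterization γ s a (variationOnFromTo γ s a t) = γ t :=
  edist_eq_zero.1 (edist_naturalParameterization_eq_zero hb.locallyBoundedVariationOn ha ht)

theorem image_variationOnFromTo (hc : ContinuousOn γ (Icc 0 1))
    (hb : BoundedVariationOn γ (Icc 0 1)) :
    variationOnFromTo γ (Icc 0 1) 0 '' Icc 0 1 = Icc 0 (pathLength γ) := by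
  have h0 : (0 : ℝ) ∈ Icc (0 : ℝ) 1 := ⟨le_rfl, zero_le_one⟩
  have h1 : (1 : ℝ) ∈ Icc (0 : ℝ) 1 := ⟨zero_le_one, le_rfl⟩
  have hm := variationOnFromTo.monotoneOn hb.locallyBoundedVariationOn h0
  apply Subset.antisymm
  · rintro _ ⟨t, ht, rfl⟩
    rw [← variationOnFromTo_zero_one]
    refine ⟨?_, hm ht h1 ht.2⟩
    simpa [variationOnFromTo.self] using hm h0 ht ht.1
  · have := intermediate_value_Icc zero_le_one (hc.variationOnFromTo hb h0)
    rwa [variationOnFromTo.self, variationOnFromTo_zero_one] at this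

/-- The variation over [s, t] of the unit-speed parametrization is t - s and dominates the distance
between the endpoints. -/
theorem norm_naturalParameterization_sub_le (hc : ContinuousOn γ (Icc 0 1))
    (hb : BoundedVariationOn γ (Icc 0 1)) {s t : ℝ} (hs : s ∈ Icc 0 (pathLength γ))
    (ht : t ∈ Icc 0 (pathLength γ)) :
    ‖naturalParameterization γ (Icc 0 1) 0 t - naturalParameterization γ (Icc 0 1) 0 s‖ ≤
      |t - s| := by
  wlog hst : s ≤ t generalizing s t
  · rw [norm_sub_rev, abs_sub_comm]
    exact this ht hs (le_of_not_ge hst)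
  have h := has_unit_speed_naturalParameterization γ hb.locallyBoundedVariationOn
    (⟨le_rfl, zero_le_one⟩ : (0 : ℝ) ∈ Icc (0 : ℝ) 1)
  rw [image_variationOnFromTo hc hb] at h
  have h1 := h hs ht
  have h2 := eVariationOn.edist_le (naturalParameterization γ (Icc 0 1) 0)
    (s := Icc 0 (pathLength γ) ∩ Icc s t) ⟨ht, hst, le_rfl⟩ ⟨hs, le_rfl, hst⟩
  rw [h1, edist_dist, dist_eq_norm, NNReal.coe_one, one_mul] at h2
  rw [abs_of_nonneg (sub_nonneg.2 hst)]
  exact (ENNReal.ofReal_le_ofReal_iff (sub_nonneg.2 hst)).1 h2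

theorem eVariationOn_le_of_edist_le {E F : Type*} [PseudoEMetricSpace E] [PseudoEMetricSpace F]
    {f : ℝ → E} {g : ℝ → F} {s : Set ℝ}
    (h : ∀ x ∈ s, ∀ y ∈ s, edist (f x) (f y) ≤ edist (g x) (g y)) :
    eVariationOn f s ≤ eVariationOn g s :=
  iSup_le fun p => (Finset.sum_le_sum fun _ _ => h _ (p.2.2.2 _) _ (p.2.2.2 _)).trans
    (eVariationOn.sum_le p.2.2.1 p.2.2.2)

end Variation

/-! ### Quasihyperbolic length and travel time -/

section Reparametrization

open Filter Topology

variable {X : Type*} [NormedAddCommGroup X] {Ω : Set X} {γ : ℝ → X}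
  {x y : X}

theorem naturalParameterization_mem (hγ : IsRectifiablePath Ω γ x y) {s : ℝ}
    (hs : s ∈ Icc 0 (pathLength γ)) : naturalParameterization γ (Icc 0 1) 0 s ∈ Ω := by
  rw [← image_variationOnFromTo hγ.continuousOn hγ.rectifiable] at hs
  obtain ⟨t, ht, rfl⟩ := hs
  rw [naturalParameterization_variationOnFromTo hγ.rectifiable ⟨le_rfl, zero_le_one⟩ ht]
  exact hγ.mapsTo ht

theorem pathLength_nonneg : 0 ≤ pathLength γ := ENNReal.toReal_nonneg

theorem quasihyperbolicLength_nonneg : 0 ≤ quasihyperbolicLength Ω γ :=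
  intervalIntegral.integral_nonneg pathLength_nonneg fun _ _ =>
    div_nonneg zero_le_one Metric.infDist_nonneg

/-- Increments of the path are dominated by those of the monotone function G, whose variation is
just its increment. -/
theorem IsQHPath.isRectifiablePath {β : ℝ → X} {T : ℝ} (hT : 0 ≤ T) (h : IsQHPath Ω β T) :
    IsRectifiablePath Ω (fun t => β (T * t)) (β 0) (β T) ∧
    ∀ s t, 0 ≤ s → s ≤ t → t ≤ 1 →
      variationOnFromTo (fun t => β (T * t)) (Icc 0 1) 0 t -
        variationOnFromTo (fun t => β (T * t)) (Icc 0 1) 0 s ≤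
      ∫ u in (T * s)..(T * t), boundaryDist Ω (β u) := by
  set γ : ℝ → X := fun t => β (T * t)
  set G : ℝ → ℝ := fun t => ∫ u in 0..(T * t), boundaryDist Ω (β u) with hG
  have hGsub : ∀ s t, G t - G s = ∫ u in (T * s)..(T * t), boundaryDist Ω (β u) := fun s t =>
    intervalIntegral.integral_interval_sub_left (h.intervalIntegrable _ _)
      (h.intervalIntegrable _ _)
  have hGm : Monotone G := fun s t hst => by
    rw [← sub_nonneg, hGsub]
    exact intervalIntegral.integral_nonneg (by gcongr) fun _ _ => Metric.infDist_nonneg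
  have hle : ∀ s t, 0 ≤ s → s ≤ t → t ≤ 1 → dist (γ s) (γ t) ≤ dist (G s) (G t) := by
    intro s t hs hst ht
    rw [dist_comm (G s), Real.dist_eq, abs_of_nonneg (sub_nonneg.2 (hGm hst)), dist_comm,
      dist_eq_norm, hGsub]
    exact h.speed _ _ (by positivity) (by gcongr) (mul_le_of_le_one_right hT ht)
  have hvar : ∀ s t, 0 ≤ s → s ≤ t → t ≤ 1 →
      eVariationOn γ (Icc 0 1 ∩ Icc s t) ≤ ENNReal.ofReal (G t - G s) := by
    intro s t hs hst ht
    have hsub : Icc (0 : ℝ) 1 ∩ Icc s t = Icc s t :=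
      inter_eq_right.2 (Icc_subset_Icc hs ht)
    rw [hsub]
    have h1 : eVariationOn γ (Icc s t) ≤ eVariationOn G (Icc s t) := by
      refine eVariationOn_le_of_edist_le fun u hu v hv => ?_
      rw [edist_dist, edist_dist]
      apply ENNReal.ofReal_le_ofReal
      rcases le_total u v with huv | huv
      · exact hle u v (hs.trans hu.1) huv (hv.2.trans ht)
      · rw [dist_comm, dist_comm (G u)]
        exact hle v u (hs.trans hv.1) huv (hu.2.trans ht)
    have h2 := (hGm.monotoneOn (Icc s t)).eVariationOn_eq (left_mem_Icc.2 hst)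
      (right_mem_Icc.2 hst)
    rw [inter_self] at h2
    exact h1.trans_eq h2
  have hbv : BoundedVariationOn γ (Icc 0 1) := by
    have := hvar 0 1 le_rfl zero_le_one le_rfl
    rw [inter_self] at this
    exact ne_top_of_le_ne_top ENNReal.ofReal_ne_top this
  refine ⟨⟨(h.continuous.comp (by fun_prop)).continuousOn, hbv, fun t _ => h.mem _,
    by simp [γ], by simp [γ]⟩, fun s t hs hst ht => ?_⟩
  rw [variationOnFromTo.sub_right hbv.locallyBoundedVariationOn ⟨le_rfl, zero_le_one⟩
    ⟨hs.trans hst, ht⟩ ⟨hs, hst.trans ht⟩, variationOnFromTo.eq_of_le _ _ hst, ← hGsub]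
  exact ENNReal.toReal_le_of_le_ofReal (sub_nonneg.2 (hGm hst)) (hvar s t hs hst ht)

variable [NormedSpace ℝ X]

/-- The length Φ accumulated up to time t is compared with T t through its right slopes. Between t
and z the arc length grows by at most w z, so d stays at least D - w z there and Φ grows by at most
w z / (D - w z), whose slope tends to T. -/
theorem IsQHPath.quasihyperbolicLength_le (hΩ : IsConvexDomain Ω) {β : ℝ → X} {T : ℝ}
    (hT : 0 ≤ T) (h : IsQHPath Ω β T) : quasihyperbolicLength Ω (fun t => β (T * t)) ≤ T := by
  obtain ⟨hrect, hvar⟩ := h.isRectifiablePath hT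
  set γ : ℝ → X := fun t => β (T * t) with hγ
  set V := variationOnFromTo γ (Icc 0 1) 0 with hV
  set N := naturalParameterization γ (Icc 0 1) 0 with hN
  have h0 : (0 : ℝ) ∈ Icc (0 : ℝ) 1 := ⟨le_rfl, zero_le_one⟩
  have hVc : ContinuousOn V (Icc 0 1) := hrect.continuousOn.variationOnFromTo hrect.rectifiable h0
  have hVmem : ∀ t ∈ Icc (0 : ℝ) 1, V t ∈ Icc 0 (pathLength γ) := fun t ht =>
    image_variationOnFromTo hrect.continuousOn hrect.rectifiable ▸ mem_image_of_mem _ ht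
  have hVm : MonotoneOn V (Icc 0 1) :=
    variationOnFromTo.monotoneOn hrect.rectifiable.locallyBoundedVariationOn h0
  have hNlip : ∀ s ∈ Icc 0 (pathLength γ), ∀ t ∈ Icc 0 (pathLength γ), ‖N t - N s‖ ≤ |t - s| :=
    fun s hs t ht =>
      norm_naturalParameterization_sub_le hrect.continuousOn hrect.rectifiable hs ht
  have hNc : ContinuousOn N (Icc 0 (pathLength γ)) := by
    refine (LipschitzOnWith.of_dist_le_mul (K := 1) fun s hs t ht => ?_).continuousOn
    rw [dist_eq_norm, Real.dist_eq, NNReal.coe_one, one_mul]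
    exact hNlip t ht s hs
  have hNd : ∀ s ∈ Icc 0 (pathLength γ), 0 < boundaryDist Ω (N s) := fun s hs =>
    hΩ.boundaryDist_pos (naturalParameterization_mem hrect hs)
  have hgc : ContinuousOn (fun s => 1 / boundaryDist Ω (N s)) (Icc 0 (pathLength γ)) :=
    continuousOn_const.div ((Metric.continuous_infDist_pt _).comp_continuousOn hNc)
      fun s hs => (hNd s hs).ne'
  have hgi : ∀ a ∈ Icc 0 (pathLength γ), ∀ b ∈ Icc 0 (pathLength γ),
      IntervalIntegrable (fun s => 1 / boundaryDist Ω (N s)) volume a b := fun a ha b hb =>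
    (hgc.mono (uIcc_subset_Icc ha hb)).intervalIntegrable
  set Φ : ℝ → ℝ := fun t => ∫ s in 0..(V t), 1 / boundaryDist Ω (N s) with hΦ
  have h0l : (0 : ℝ) ∈ Icc 0 (pathLength γ) := ⟨le_rfl, pathLength_nonneg⟩
  have hV0 : V 0 = 0 := variationOnFromTo.self _ _ _
  have hΦc : ContinuousOn Φ (Icc 0 1) := by
    have h1 : ContinuousOn (fun r => ∫ s in 0..r, 1 / boundaryDist Ω (N s))
        (Icc 0 (pathLength γ)) := by
      have := intervalIntegral.continuousOn_primitive_interval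
        (f := fun s => 1 / boundaryDist Ω (N s)) (μ := volume) (a := 0) (b := pathLength γ)
        (by rw [uIcc_of_le pathLength_nonneg]; exact hgc.integrableOn_Icc)
      rwa [uIcc_of_le pathLength_nonneg] at this
    exact h1.comp hVc hVmem
  have key : ∀ t ∈ Icc (0 : ℝ) 1, Φ t ≤ T * t := by
    refine image_le_of_liminf_slope_right_le_deriv_boundary (B' := fun _ => T) hΦc
      (by simp [hΦ, hV0]) (by fun_prop)
      (fun t _ => by simpa using ((hasDerivAt_id t).const_mul T).hasDerivWithinAt)
      fun t ht r hr => Eventually.frequently ?_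
    have ht' : t ∈ Icc (0 : ℝ) 1 := ⟨ht.1, ht.2.le⟩
    set D := boundaryDist Ω (γ t) with hD
    have hDpos : 0 < D := hΩ.boundaryDist_pos (hrect.mapsTo ht')
    set w : ℝ → ℝ := fun z => ∫ u in (T * t)..(T * z), boundaryDist Ω (β u) with hw
    have hwd : HasDerivAt w (D * T) t := by
      have h1 : HasDerivAt (fun r => ∫ u in (T * t)..r, boundaryDist Ω (β u)) D (T * t) :=
        intervalIntegral.integral_hasDerivAt_right (h.intervalIntegrable _ _)
          (h.continuous_boundaryDist.stronglyMeasurableAtFilter _ _)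
          h.continuous_boundaryDist.continuousAt
      have h2 : HasDerivAt (fun z => T * z) T t := by simpa using (hasDerivAt_id t).const_mul T
      exact HasDerivAt.comp t h1 h2
    have hw0 : w t = 0 := intervalIntegral.integral_same
    have hwt : Tendsto w (𝓝[>] t) (𝓝 0) := by
      have := hwd.continuousAt.tendsto.mono_left (nhdsWithin_le_nhds (s := Ioi t))
      rwa [hw0] at this
    have hslope : Tendsto (fun z => slope w t z / (D - w z)) (𝓝[>] t) (𝓝 T) := by
      have h1 : Tendsto (slope w t) (𝓝[>] t) (𝓝 (D * T)) :=
        (hasDerivAt_iff_tendsto_slope.1 hwd).mono_left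
          (nhdsWithin_mono _ fun z hz => (ne_of_gt hz : z ≠ t))
      have h2 := h1.div (tendsto_const_nhds.sub hwt) (by simpa using hDpos.ne')
      rw [sub_zero, mul_div_cancel_left₀ _ hDpos.ne'] at h2
      exact h2
    filter_upwards [hslope.eventually_lt_const hr, hwt.eventually_lt_const hDpos,
      self_mem_nhdsWithin, Ioo_mem_nhdsGT ht.2] with z hz1 hz2 hz3 hz4
    refine lt_of_le_of_lt ?_ hz1
    have hz : z ∈ Icc (0 : ℝ) 1 := ⟨ht.1.trans hz4.1.le, hz4.2.le⟩
    have hztpos : 0 < z - t := sub_pos.2 hz4.1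
    have hVw : V z - V t ≤ w z := hvar t z ht.1 hz4.1.le hz4.2.le
    have hVtz : V t ≤ V z := hVm ht' hz hz4.1.le
    have hsub : Φ z - Φ t = ∫ s in (V t)..(V z), 1 / boundaryDist Ω (N s) :=
      intervalIntegral.integral_interval_sub_left (hgi _ h0l _ (hVmem z hz))
        (hgi _ h0l _ (hVmem t ht'))
    have hbound : Φ z - Φ t ≤ (V z - V t) * (1 / (D - w z)) := by
      rw [hsub, ← smul_eq_mul, ← intervalIntegral.integral_const]
      refine intervalIntegral.integral_mono_on hVtz (hgi _ (hVmem t ht') _ (hVmem z hz))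
        (by simp) fun s hs => ?_
      have hs' : s ∈ Icc 0 (pathLength γ) :=
        ⟨(hVmem t ht').1.trans hs.1, hs.2.trans (hVmem z hz).2⟩
      apply one_div_le_one_div_of_le (sub_pos.2 hz2)
      have h1 := (abs_le.1 (abs_boundaryDist_sub_le Ω (N s) (N (V t)))).1
      have h2 := hNlip _ (hVmem t ht') _ hs'
      rw [abs_of_nonneg (sub_nonneg.2 hs.1)] at h2
      have h3 : N (V t) = γ t :=
        naturalParameterization_variationOnFromTo hrect.rectifiable h0 ht'
      rw [h3] at h1 h2
      linarith [hs.2]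
    rw [slope_def_field, slope_def_field, hw0, sub_zero, div_div,
      div_le_div_iff₀ hztpos (mul_pos hztpos (sub_pos.2 hz2))]
    have h4 : (Φ z - Φ t) * (D - w z) ≤ w z := by
      have h5 := mul_le_mul_of_nonneg_right hbound (sub_pos.2 hz2).le
      rw [mul_assoc, one_div, inv_mul_cancel₀ (sub_pos.2 hz2).ne', mul_one] at h5
      exact h5.trans hVw
    calc (Φ z - Φ t) * ((z - t) * (D - w z)) = ((Φ z - Φ t) * (D - w z)) * (z - t) := by ring
      _ ≤ w z * (z - t) := by gcongr
  have := key 1 ⟨zero_le_one, le_rfl⟩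
  simp only [hΦ, hV, variationOnFromTo_zero_one, mul_one] at this
  exact this

/-- Parametrizing by quasihyperbolic length φ works: the inverse ψ of φ satisfies ψ' = d(N ∘ ψ),
which is exactly the speed allowed. -/
theorem IsRectifiablePath.exists_isQHPath (hΩ : IsConvexDomain Ω)
    (hγ : IsRectifiablePath Ω γ x y) :
    ∃ β, IsQHPath Ω β (quasihyperbolicLength Ω γ) ∧ β 0 = x ∧
      β (quasihyperbolicLength Ω γ) = y := by
  set l := pathLength γ with hl
  have hl0 : 0 ≤ l := pathLength_nonneg
  set N₀ := naturalParameterization γ (Icc 0 1) 0 with hN₀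
  set N : ℝ → X := fun s => N₀ (projIcc 0 l hl0 s) with hN
  have hNlip : ∀ s t, ‖N t - N s‖ ≤ |t - s| := fun s t =>
    (norm_naturalParameterization_sub_le hγ.continuousOn hγ.rectifiable (Subtype.coe_prop _)
      (Subtype.coe_prop _)).trans (abs_projIcc_sub_projIcc hl0)
  have hNc : Continuous N := by
    refine (LipschitzWith.of_dist_le_mul (K := 1) fun s t => ?_).continuous
    rw [dist_eq_norm, Real.dist_eq, NNReal.coe_one, one_mul]
    exact hNlip t s
  have hNmem : ∀ s, N s ∈ Ω := fun s => naturalParameterization_mem hγ (Subtype.coe_prop _)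
  have hNd : ∀ s, 0 < boundaryDist Ω (N s) := fun s => hΩ.boundaryDist_pos (hNmem s)
  have hdc : Continuous fun s => boundaryDist Ω (N s) :=
    (Metric.continuous_infDist_pt _).comp hNc
  set h : ℝ → ℝ := fun s => 1 / boundaryDist Ω (N s) with hh
  have hpos : ∀ s, 0 < h s := fun s => one_div_pos.2 (hNd s)
  have hc : Continuous h := continuous_const.div hdc fun s => (hNd s).ne'
  -- The upper bound C on d gives φ' ≥ 1 / C. Since N is extended by constants beyond [0, l], φ is
  -- thus a bijection of the whole line and ψ is defined everywhere.
  obtain ⟨C, hC⟩ : ∃ C, ∀ s, boundaryDist Ω (N s) ≤ C := by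
    refine ⟨boundaryDist Ω (N 0) + l, fun s => ?_⟩
    have h1 := (abs_le.1 (abs_boundaryDist_sub_le Ω (N s) (N 0))).2
    have h2 : ‖N s - N 0‖ ≤ l := by
      refine (norm_naturalParameterization_sub_le hγ.continuousOn hγ.rectifiable
        (Subtype.coe_prop (projIcc 0 l hl0 0)) (Subtype.coe_prop (projIcc 0 l hl0 s))).trans ?_
      have h3 := (projIcc 0 l hl0 0).2
      have h4 := (projIcc 0 l hl0 s).2
      rw [abs_le]
      constructor <;> linarith [h3.1, h3.2, h4.1, h4.2]
    linarith
  have hCpos : 0 < C := (hNd 0).trans_le (hC 0)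
  have hCh : ∀ s, 1 / C ≤ h s := fun s => one_div_le_one_div_of_le (hNd s) (hC s)
  set φ : ℝ → ℝ := fun s => ∫ u in 0..s, h u with hφ
  have hφd : ∀ s, HasDerivAt φ (h s) s := fun s =>
    intervalIntegral.integral_hasDerivAt_right (hc.intervalIntegrable _ _)
      (hc.stronglyMeasurableAtFilter _ _) hc.continuousAt
  have hφc : Continuous φ := continuous_iff_continuousAt.2 fun s => (hφd s).continuousAt
  have hφm : StrictMono φ := strictMono_of_deriv_pos fun s => by
    rw [(hφd s).deriv]
    exact hpos s
  have hφ0 : φ 0 = 0 := intervalIntegral.integral_same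
  have hφC : Monotone fun s => φ s - 1 / C * s := by
    have hd : ∀ s, HasDerivAt (fun s => φ s - 1 / C * s) (h s - 1 / C) s := fun s => by
      have := (hφd s).sub ((hasDerivAt_id s).const_mul (1 / C))
      rwa [mul_one] at this
    refine monotone_of_deriv_nonneg (fun s => (hd s).differentiableAt) fun s => ?_
    rw [(hd s).deriv]
    linarith [hCh s]
  have hCpos' : 0 < 1 / C := one_div_pos.2 hCpos
  have hsurj : Function.Surjective φ := by
    refine hφc.surjective ?_ ?_
    · refine tendsto_atTop_mono' _ ?_ (tendsto_id.const_mul_atTop hCpos')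
      filter_upwards [eventually_ge_atTop 0] with s hs
      have := hφC hs
      simp only [hφ0, mul_zero, sub_zero] at this
      simpa using this
    · refine tendsto_atBot_mono' _ ?_ (tendsto_id.const_mul_atBot hCpos')
      filter_upwards [eventually_le_atBot 0] with s hs
      have := hφC hs
      simp only [hφ0, mul_zero, sub_zero] at this
      simpa using this
  let e : ℝ ≃o ℝ := StrictMono.orderIsoOfSurjective φ hφm hsurj
  let ψ : ℝ → ℝ := fun t => e.symm t
  have hφψ : ∀ t, φ (ψ t) = t := fun t => e.apply_symm_apply t
  have hψφ : ∀ s, ψ (φ s) = s := fun s => e.symm_apply_apply s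
  have hψc : Continuous ψ := e.symm.continuous
  have hψm : Monotone ψ := e.symm.monotone
  have hψd : ∀ t, HasDerivAt ψ (boundaryDist Ω (N (ψ t))) t := fun t => by
    have := (hφd (ψ t)).of_local_left_inverse hψc.continuousAt (hpos _).ne'
      (Eventually.of_forall hφψ)
    simpa [hh] using this
  have hφl : φ l = quasihyperbolicLength Ω γ := by
    refine intervalIntegral.integral_congr fun s hs => ?_
    rw [uIcc_of_le hl0] at hs
    simp only [hh, hN, projIcc_of_mem hl0 hs]
    rfl
  have h0 : (0 : ℝ) ∈ Icc (0 : ℝ) 1 := ⟨le_rfl, zero_le_one⟩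
  have h1 : (1 : ℝ) ∈ Icc (0 : ℝ) 1 := ⟨zero_le_one, le_rfl⟩
  refine ⟨fun t => N (ψ t), ⟨hNc.comp hψc, fun t => hNmem _, fun s t _ hst _ => ?_⟩, ?_, ?_⟩
  · refine (hNlip _ _).trans_eq ?_
    rw [abs_of_nonneg (sub_nonneg.2 (hψm hst))]
    exact (intervalIntegral.integral_eq_sub_of_hasDerivAt (fun u _ => hψd u)
      ((hdc.comp hψc).intervalIntegrable _ _)).symm
  · have h2 := naturalParameterization_variationOnFromTo hγ.rectifiable h0 h0
    rw [variationOnFromTo.self, hγ.source] at h2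
    have h3 : ψ 0 = 0 := by rw [← hφ0, hψφ, hφ0]
    simp only [hN, h3, projIcc_of_mem hl0 ⟨le_rfl, hl0⟩]
    exact h2
  · have h2 := naturalParameterization_variationOnFromTo hγ.rectifiable h0 h1
    rw [variationOnFromTo_zero_one, hγ.target] at h2
    simp only [hN, ← hφl, hψφ, projIcc_of_mem hl0 ⟨hl0, le_rfl⟩]
    exact h2

theorem quasihyperbolicDist_lt_iff (hΩ : IsConvexDomain Ω) (hx : x ∈ Ω) (hy : y ∈ Ω) {r : ℝ} :
    quasihyperbolicDist Ω x y < r ↔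
      ∃ T, 0 ≤ T ∧ T < r ∧ ∃ γ, IsQHPath Ω γ T ∧ γ 0 = x ∧ γ T = y := by
  have hbdd : BddBelow {l : ℝ | ∃ γ : ℝ → X, IsRectifiablePath Ω γ x y ∧
      l = quasihyperbolicLength Ω γ} :=
    ⟨0, by rintro _ ⟨γ, -, rfl⟩; exact quasihyperbolicLength_nonneg⟩
  constructor
  · intro h
    -- Needed because `sInf` of the empty set of reals is 0.
    have hne : {l : ℝ | ∃ γ : ℝ → X, IsRectifiablePath Ω γ x y ∧
        l = quasihyperbolicLength Ω γ}.Nonempty := by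
      obtain ⟨γ, hγ, h0, h1⟩ := hΩ.exists_isQHPath_segment hx hy
      have hrect := (hγ.isRectifiablePath
        (div_nonneg (norm_nonneg _) (le_min Metric.infDist_nonneg Metric.infDist_nonneg))).1
      rw [h0, h1] at hrect
      exact ⟨_, _, hrect, rfl⟩
    obtain ⟨_, ⟨γ, hγ, rfl⟩, hlt⟩ := (csInf_lt_iff hbdd hne).1 h
    exact ⟨_, quasihyperbolicLength_nonneg, hlt, hγ.exists_isQHPath hΩ⟩
  · rintro ⟨T, hT, hTr, γ, hγ, rfl, rfl⟩
    exact (csInf_le hbdd ⟨_, (hγ.isRectifiablePath hT).1, rfl⟩).trans_lt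
      ((hγ.quasihyperbolicLength_le hΩ hT).trans_lt hTr)

end Reparametrization

/-! ### Strict convexity criteria -/

section ConvexSets

variable {E : Type*} [NormedAddCommGroup E] [NormedSpace ℝ E] {s : Set E}

/-- A ray from x leaves the bounded set, hence crosses the boundary. The nearer of two crossings
would be a combination, with positive weight on the interior point x, of x and a closure point,
hence interior. -/
theorem IsStrictlyConvexOpen.of_isBounded (hc : Convex ℝ s) (ho : IsOpen s)
    (hb : Bornology.IsBounded s) : IsStrictlyConvexOpen s := by
  refine ⟨ho, fun x hx => ⟨hc.starConvex hx, fun v hv => ?_⟩⟩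
  have hnf : ∀ p ∈ s, p ∉ frontier s := fun p hp h => by
    rw [ho.frontier_eq] at h
    exact h.2 hp
  obtain ⟨C, hC⟩ := hb.exists_norm_le
  have hv' : 0 < ‖v‖ := norm_pos_iff.2 hv
  have hray : IsPreconnected ((fun t : ℝ => x + t • v) '' Ici 0) :=
    isPreconnected_Ici.image _ (by fun_prop)
  obtain ⟨-, ⟨t, ht, rfl⟩, htf⟩ := hray.inter_frontier_nonempty (u := s)
    ⟨x, ⟨0, self_mem_Ici, by simp⟩, hx⟩ (by
      -- This step has norm C + ‖x‖ + 1, so it ends outside the ball of radius C about 0.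
      refine ⟨_, ⟨(C + ‖x‖ + 1) / ‖v‖, ?_, rfl⟩, fun hmem => ?_⟩
      · have := (norm_nonneg x).trans (hC x hx)
        exact div_nonneg (by positivity) hv'.le
      · have h1 := hC _ hmem
        have h0 := (norm_nonneg x).trans (hC x hx)
        have h2 : ‖((C + ‖x‖ + 1) / ‖v‖) • v‖ = C + ‖x‖ + 1 := by
          rw [norm_smul, Real.norm_of_nonneg (by positivity), div_mul_cancel₀ _ hv'.ne']
        have h3 := norm_sub_le (x + ((C + ‖x‖ + 1) / ‖v‖) • v) x
        rw [add_sub_cancel_left, h2] at h3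
        linarith)
  have huniq : ∀ t₁ t₂ : ℝ, 0 ≤ t₁ → x + t₁ • v ∈ frontier s → x + t₂ • v ∈ frontier s →
      t₂ ≤ t₁ := by
    intro t₁ t₂ h1 hf1 hf2
    by_contra hlt
    push Not at hlt
    have h2 : 0 < t₂ := h1.trans_lt hlt
    have hmem := hc.combo_interior_closure_mem_interior (ho.interior_eq.symm ▸ hx) hf2.1
      (a := 1 - t₁ / t₂) (b := t₁ / t₂) (by rw [sub_pos, div_lt_one h2]; exact hlt)
      (div_nonneg h1 h2.le) (by ring)
    have heq : (1 - t₁ / t₂) • x + (t₁ / t₂) • (x + t₂ • v) = x + t₁ • v := by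
      rw [smul_add, smul_smul, div_mul_cancel₀ _ h2.ne', ← add_assoc, ← add_smul,
        sub_add_cancel, one_smul]
    rw [heq] at hmem
    exact hf1.2 hmem
  exact ⟨t, ⟨ht, htf⟩, fun t' ⟨ht', htf'⟩ =>
    le_antisymm (huniq t t' ht htf htf') (huniq t' t ht' htf' htf)⟩

/-- Any other point of the open segment lies strictly between the interior midpoint and an endpoint.
-/
theorem Convex.strictConvex_of_midpoint_mem_interior (hc : Convex ℝ s)
    (h : ∀ y ∈ s, ∀ z ∈ s, y ≠ z → midpoint ℝ y z ∈ interior s) : StrictConvex ℝ s := by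
  intro y hy z hz hyz a b ha hb hab
  have hm := h y hy z hz hyz
  have hseg : a • y + b • z ∈ openSegment ℝ y z := ⟨a, b, ha, hb, hab, rfl⟩
  rcases openSegment_subset_union (𝕜 := ℝ) y z
    (z := midpoint ℝ y z) (mem_range_self _) hseg with h1 | h1 | h1
  · rwa [h1]
  · exact hc.openSegment_closure_interior_subset_interior (subset_closure hy) hm h1
  · rw [openSegment_symm] at h1
    exact hc.openSegment_closure_interior_subset_interior (subset_closure hz) hm h1

end ConvexSets

/-- Two points are joined by a path of quasihyperbolic speed at most one over a time interval of
length `T`. -/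
def QHJoin {X : Type*} [NormedAddCommGroup X] (Ω : Set X) (T : ℝ) (x y : X) : Prop :=
  0 ≤ T ∧ ∃ γ, IsQHPath Ω γ T ∧ γ 0 = x ∧ γ T = y

namespace QHJoin

variable {X : Type*} [NormedAddCommGroup X] {Ω : Set X} {x y z : X} {S T : ℝ}

theorem mono (h : QHJoin Ω T x y) (hTS : T ≤ S) : QHJoin Ω S x y := by
  obtain ⟨hT, γ, hγ, h0, h1⟩ := h
  refine ⟨hT.trans hTS, _, hγ.extend S, ?_, ?_⟩
  · simpa [min_eq_left hT] using h0
  · simpa [min_eq_right hTS] using h1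

theorem trans (h : QHJoin Ω T x y) (h' : QHJoin Ω S y z) : QHJoin Ω (T + S) x z := by
  obtain ⟨hT, γ, hγ, h0, h1⟩ := h
  obtain ⟨hS, δ, hδ, h0', h1'⟩ := h'
  refine ⟨add_nonneg hT hS, _, hγ.trans hδ (h0'.trans h1.symm), ?_, ?_⟩
  · simpa [hT] using h0
  · rcases hS.eq_or_lt with rfl | hS
    · simp [h1, ← h1', h0']
    · simpa [hS.not_ge] using h1'

theorem mem_right (h : QHJoin Ω T x y) : y ∈ Ω := by
  obtain ⟨-, γ, hγ, -, rfl⟩ := h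
  exact hγ.mem _

theorem le_boundaryDist (h : QHJoin Ω T x y) :
    boundaryDist Ω x ≤ boundaryDist Ω y * Real.exp T := by
  obtain ⟨hT, γ, hγ, rfl, rfl⟩ := h
  simpa using hγ.le_boundaryDist le_rfl hT le_rfl

theorem norm_sub_le (h : QHJoin Ω T x y) :
    ‖y - x‖ ≤ boundaryDist Ω x * (Real.exp T - 1) := by
  obtain ⟨hT, γ, hγ, rfl, rfl⟩ := h
  simpa using hγ.norm_sub_le le_rfl hT le_rfl

end QHJoin

/-! ### Convexity and strict convexity of quasihyperbolic balls -/

section QuasihyperbolicBall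

variable {X : Type*} [NormedAddCommGroup X] [NormedSpace ℝ X] {Ω : Set X} {x y z : X} {r T : ℝ}

theorem IsConvexDomain.qhJoin_of_norm_sub_le (hΩ : IsConvexDomain Ω) {m : ℝ} (hm : 0 < m)
    (hx : x ∈ Ω) (hy : y ∈ Ω) (hmx : m ≤ boundaryDist Ω x) (hmy : m ≤ boundaryDist Ω y)
    (h : ‖x - y‖ ≤ T * m) : QHJoin Ω T x y := by
  have h0 : 0 ≤ ‖x - y‖ / min (boundaryDist Ω x) (boundaryDist Ω y) :=
    div_nonneg (norm_nonneg _) (hm.le.trans (le_min hmx hmy))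
  refine QHJoin.mono ⟨h0, hΩ.exists_isQHPath_segment hx hy⟩ ?_
  refine (div_le_div_of_nonneg_left (norm_nonneg _) hm (le_min hmx hmy)).trans ?_
  rwa [div_le_iff₀ hm]

theorem mem_quasihyperbolicBall_iff (hΩ : IsConvexDomain Ω) (hx : x ∈ Ω) :
    y ∈ quasihyperbolicBall Ω x r ↔ ∃ T < r, QHJoin Ω T x y := by
  constructor
  · rintro ⟨hy, h⟩
    obtain ⟨T, hT, hTr, h⟩ := (quasihyperbolicDist_lt_iff hΩ hx hy).1 h
    exact ⟨T, hTr, hT, h⟩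
  · rintro ⟨T, hTr, h⟩
    exact ⟨h.mem_right, (quasihyperbolicDist_lt_iff hΩ hx h.mem_right).2 ⟨T, h.1, hTr, h.2⟩⟩

theorem convex_quasihyperbolicBall (hΩ : IsConvexDomain Ω) (hx : x ∈ Ω) (r : ℝ) :
    Convex ℝ (quasihyperbolicBall Ω x r) := by
  intro y hy z hz a b ha hb hab
  rw [mem_quasihyperbolicBall_iff hΩ hx] at *
  obtain ⟨T, hT, h1⟩ := hy
  obtain ⟨S, hS, h2⟩ := hz
  -- A common duration M lets the two paths be averaged at equal times.
  obtain ⟨M, hM1, hM2⟩ := exists_between (max_lt hT hS)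
  have hMpos : 0 < M := h1.1.trans_lt ((le_max_left _ _).trans_lt hM1)
  obtain ⟨-, γ, hγ, hγ0, hγ1⟩ := h1.mono ((le_max_left _ _).trans hM1.le)
  obtain ⟨-, δ, hδ, hδ0, hδ1⟩ := h2.mono ((le_max_right _ _).trans hM1.le)
  refine ⟨M, hM2, hMpos.le, _, hγ.average hΩ hMpos.le hMpos.le hδ hMpos ha hb hab
    fun t _ _ => ?_, ?_, ?_⟩
  · have := hΩ.concaveOn_boundaryDist.2 (hγ.mem (M * t)) (hδ.mem (M * t)) ha hb hab
    have := mul_le_mul_of_nonneg_left this hMpos.le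
    simp only [smul_eq_mul] at this
    linarith
  · simp [hγ0, hδ0, ← add_smul, hab]
  · simp [hγ1, hδ1, hMpos.ne']

theorem isOpen_quasihyperbolicBall (hΩ : IsConvexDomain Ω) (hx : x ∈ Ω) (r : ℝ) :
    IsOpen (quasihyperbolicBall Ω x r) := by
  refine Metric.isOpen_iff.2 fun y hy => ?_
  rw [mem_quasihyperbolicBall_iff hΩ hx] at hy
  obtain ⟨T, hT, h⟩ := hy
  obtain ⟨T', hT1, hT2⟩ := exists_between hT
  have hd := hΩ.boundaryDist_pos h.mem_right
  refine ⟨min (boundaryDist Ω y / 2) ((T' - T) * (boundaryDist Ω y / 2)),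
    lt_min (by positivity) (mul_pos (sub_pos.2 hT1) (by positivity)), fun z hz => ?_⟩
  rw [Metric.mem_ball, dist_comm, dist_eq_norm, lt_min_iff] at hz
  have hzΩ : z ∈ Ω := hΩ.ball_subset h.mem_right (by
    rw [Metric.mem_ball, dist_comm, dist_eq_norm]
    linarith)
  have h2 := (abs_le.1 (abs_boundaryDist_sub_le Ω y z)).2
  have h3 : QHJoin Ω (T' - T) y z := hΩ.qhJoin_of_norm_sub_le (half_pos hd) h.mem_right hzΩ
    (by linarith) (by linarith) hz.2.le
  refine (mem_quasihyperbolicBall_iff hΩ hx).2 ⟨T', hT2, ?_⟩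
  simpa using h.trans h3

theorem isBounded_quasihyperbolicBall (hΩ : IsConvexDomain Ω) (hx : x ∈ Ω) (r : ℝ) :
    Bornology.IsBounded (quasihyperbolicBall Ω x r) := by
  refine Metric.isBounded_closedBall.subset
    (t := Metric.closedBall x (boundaryDist Ω x * (Real.exp r - 1))) fun y hy => ?_
  obtain ⟨T, hT, h⟩ := (mem_quasihyperbolicBall_iff hΩ hx).1 hy
  rw [Metric.mem_closedBall, dist_eq_norm]
  refine h.norm_sub_le.trans ?_
  have := Real.exp_le_exp.2 hT.le
  exact mul_le_mul_of_nonneg_left (by linarith) Metric.infDist_nonneg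

/-- On the ball d is at least d(x) exp (-r), a bound that survives closure and keeps y in Ω. A point
of the ball close enough to y is then joined to y by a segment in the spare time T - r. -/
theorem qhJoin_of_mem_closure_quasihyperbolicBall (hΩ : IsConvexDomain Ω) (hx : x ∈ Ω)
    (hy : y ∈ closure (quasihyperbolicBall Ω x r)) (hT : r < T) : QHJoin Ω T x y := by
  have hd := hΩ.boundaryDist_pos hx
  set m := boundaryDist Ω x * Real.exp (-r) with hm
  have hmpos : 0 < m := by positivity
  have hball : ∀ z ∈ quasihyperbolicBall Ω x r, QHJoin Ω r x z ∧ m ≤ boundaryDist Ω z := by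
    intro z hz
    obtain ⟨S, hS, h⟩ := (mem_quasihyperbolicBall_iff hΩ hx).1 hz
    refine ⟨h.mono hS.le, ?_⟩
    rw [hm, Real.exp_neg, ← div_eq_mul_inv, div_le_iff₀ (Real.exp_pos _)]
    exact (h.mono hS.le).le_boundaryDist
  have hmy : m ≤ boundaryDist Ω y :=
    closure_minimal (fun z hz => (hball z hz).2)
      (isClosed_le continuous_const (Metric.continuous_infDist_pt (frontier Ω))) hy
  have hyΩ : y ∈ Ω :=
    hΩ.mem_of_mem_closure (closure_mono (fun z hz => hz.1) hy) (hmpos.trans_le hmy)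
  obtain ⟨z, hz, hyz⟩ := Metric.mem_closure_iff.1 hy ((T - r) * m)
    (mul_pos (sub_pos.2 hT) hmpos)
  rw [dist_comm, dist_eq_norm] at hyz
  have := (hball z hz).1.trans (hΩ.qhJoin_of_norm_sub_le hmpos hz.1 hyΩ (hball z hz).2 hmy hyz.le)
  simpa using this

/-- Averaging a subpath of `α` of duration `τ` with a subpath of `β` of duration `τ'`. -/
theorem IsQHPath.qhJoin_midpoint (hΩ : IsConvexDomain Ω) {α β : ℝ → X} {S p q τ τ' M : ℝ}
    (hα : IsQHPath Ω α T) (hβ : IsQHPath Ω β S) (hp : 0 ≤ p) (hτ : 0 ≤ τ) (hpT : p + τ ≤ T)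
    (hq : 0 ≤ q) (hτ' : 0 ≤ τ') (hqS : q + τ' ≤ S) (hM : 0 < M)
    (h : ∀ u ∈ Icc p (p + τ), ∀ v ∈ Icc q (q + τ'),
      τ * boundaryDist Ω (α u) + τ' * boundaryDist Ω (β v) ≤
        2 * M * boundaryDist Ω (midpoint ℝ (α u) (β v))) :
    QHJoin Ω M (midpoint ℝ (α p) (β q)) (midpoint ℝ (α (p + τ)) (β (q + τ'))) := by
  have hmid : ∀ a b : X, (1 / 2 : ℝ) • a + (1 / 2 : ℝ) • b = midpoint ℝ a b := fun a b => by
    rw [midpoint_eq_smul_add, smul_add, one_div, invOf_eq_inv]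
  refine ⟨hM.le, _, IsQHPath.average (a := 1 / 2) (b := 1 / 2) hΩ hτ hτ'
    ((hα.shift hp).mono (by linarith)) ((hβ.shift hq).mono (by linarith)) hM (by norm_num)
    (by norm_num) (by norm_num) fun t h0 h1 => ?_, ?_, ?_⟩
  · have h2 : τ * t ≤ τ := mul_le_of_le_one_right hτ h1
    have h3 : τ' * t ≤ τ' := mul_le_of_le_one_right hτ' h1
    have h4 : 0 ≤ τ * t := mul_nonneg hτ h0
    have h5 : 0 ≤ τ' * t := mul_nonneg hτ' h0
    have := h (p + τ * t) ⟨by linarith, by linarith⟩ (q + τ' * t) ⟨by linarith, by linarith⟩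
    simp only [hmid]
    linarith
  · simp only [hmid, zero_div, mul_zero, add_zero]
  · simp only [hmid, div_self hM.ne', mul_one]

theorem IsConvexDomain.add_boundaryDist_le (hΩ : IsConvexDomain Ω) (hx : x ∈ Ω) (hy : y ∈ Ω) :
    boundaryDist Ω x + boundaryDist Ω y ≤ 2 * boundaryDist Ω (midpoint ℝ x y) := by
  have h2 : (0 : ℝ) ≤ 1 / 2 := by norm_num
  have := hΩ.concaveOn_boundaryDist.2 hx hy h2 h2 (by norm_num)
  rw [midpoint_eq_smul_add, smul_add, invOf_eq_inv, ← one_div]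
  simp only [smul_eq_mul] at this
  linarith

/-- The midpoint of two points on a quasihyperbolic sphere at different distances from the boundary
is inside: the path towards the point further from the boundary is run faster at first. -/
theorem exists_qhJoin_midpoint_of_boundaryDist_lt (hΩ : IsConvexDomain Ω) (hx : x ∈ Ω)
    (hr : 0 < r) (hy : ∀ T > r, QHJoin Ω T x y) (hz : ∀ T > r, QHJoin Ω T x z)
    (hyz : boundaryDist Ω y < boundaryDist Ω z) :
    ∃ T < r, QHJoin Ω T x (midpoint ℝ y z) := by
  have hdx := hΩ.boundaryDist_pos hx
  have hdy := hΩ.boundaryDist_pos (hy (r + 1) (by simp)).mem_right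
  have hdz := hΩ.boundaryDist_pos (hz (r + 1) (by simp)).mem_right
  have hlog : 0 < Real.log (boundaryDist Ω z / boundaryDist Ω y) :=
    Real.log_pos ((one_lt_div hdy).2 hyz)
  -- The bound 4c ≤ r leaves room for an initial and a final phase. With 16c, the ratio d(z) / d(y)
  -- still exceeds ρ ^ 3 = exp (12c) after a loss of at most exp (4c) in the final phase.
  obtain ⟨c, hc, hcr, hclog⟩ : ∃ c : ℝ, 0 < c ∧ 4 * c ≤ r ∧
      16 * c ≤ Real.log (boundaryDist Ω z / boundaryDist Ω y) := by
    refine ⟨min (r / 4) (Real.log (boundaryDist Ω z / boundaryDist Ω y) / 16),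
      lt_min (by positivity) (by positivity), ?_, ?_⟩
    · linarith [min_le_left (r / 4) (Real.log (boundaryDist Ω z / boundaryDist Ω y) / 16)]
    · linarith [min_le_right (r / 4) (Real.log (boundaryDist Ω z / boundaryDist Ω y) / 16)]
  have hratio : boundaryDist Ω y * Real.exp (16 * c) ≤ boundaryDist Ω z := by
    have := Real.exp_le_exp.2 hclog
    rw [Real.exp_log (div_pos hdz hdy), le_div_iff₀ hdy] at this
    linarith
  set ρ := Real.exp (4 * c) with hρ
  have hρ1 : 1 < ρ := Real.one_lt_exp_iff.2 (by positivity)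
  have hρ0 : 0 < ρ := Real.exp_pos _
  have hρ3 : ρ ^ 3 = Real.exp (12 * c) := by
    rw [hρ, ← Real.exp_nat_mul]
    congr 1
    push_cast
    ring
  -- These bound the weight d(β v) / (d(α u) + d(β v)) of the second path: at most κ₁ in the initial
  -- phase, at least κ₃ in the final one. Lending β the time σ costs at most σ κ₁, and taking it
  -- back saves at least σ κ₃.
  set κ₁ := ρ / (1 + ρ) with hκ₁
  set κ₃ := ρ ^ 3 / (1 + ρ ^ 3) with hκ₃
  have hκ₁0 : 0 < κ₁ := by positivity
  have hκ₃1 : κ₃ < 1 := by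
    rw [hκ₃, div_lt_one (by positivity)]
    linarith
  have hκ : κ₁ < κ₃ := by
    rw [hκ₁, hκ₃, div_lt_div_iff₀ (by positivity) (by positivity)]
    have : ρ ^ 1 < ρ ^ 3 := pow_lt_pow_right₀ hρ1 (by norm_num)
    linarith
  set σ := c / 2 with hσ
  have hσ0 : 0 < σ := by positivity
  have hgain : 0 < σ * (κ₃ - κ₁) := mul_pos hσ0 (sub_pos.2 hκ)
  -- The excess over r is half the saving, so the total time T - σ (κ₃ - κ₁) falls below r.
  set T := r + σ * (κ₃ - κ₁) / 2 with hT
  have hTr : r < T := by linarith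
  have hT0 : 0 ≤ T := hr.le.trans hTr.le
  obtain ⟨-, α, hα, hα0, hα1⟩ := hy T hTr
  obtain ⟨-, β, hβ, hβ0, hβ1⟩ := hz T hTr
  have J1 := hα.qhJoin_midpoint hΩ hβ (p := 0) (τ := c) (q := 0) (τ' := c + σ) (M := c + σ * κ₁)
    le_rfl hc.le (by linarith) le_rfl (by linarith) (by linarith) (by positivity) (by
      intro u hu v hv
      have hm := hΩ.add_boundaryDist_le (hα.mem u) (hβ.mem v)
      have h1 := hα.le_boundaryDist le_rfl hu.1 (t := u) (by linarith [hu.2])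
      have h2 := hβ.boundaryDist_le le_rfl hv.1 (t := v) (by linarith [hv.2])
      rw [hα0, sub_zero] at h1
      rw [hβ0, sub_zero] at h2
      have h3 : boundaryDist Ω (β v) ≤ ρ * boundaryDist Ω (α u) := by
        calc _ ≤ boundaryDist Ω (α u) * Real.exp u * Real.exp v := h2.trans (by gcongr)
          _ = boundaryDist Ω (α u) * Real.exp (u + v) := by rw [mul_assoc, Real.exp_add]
          _ ≤ boundaryDist Ω (α u) * ρ := mul_le_mul_of_nonneg_left
              (Real.exp_le_exp.2 (by linarith [hu.2, hv.2])) Metric.infDist_nonneg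
          _ = _ := mul_comm _ _
      have h4 : boundaryDist Ω (β v) ≤
          κ₁ * (boundaryDist Ω (α u) + boundaryDist Ω (β v)) := by
        rw [hκ₁, div_mul_eq_mul_div, le_div_iff₀ (by positivity)]
        linarith
      have h5 := mul_le_mul_of_nonneg_left h4 hσ0.le
      have h6 := mul_le_mul_of_nonneg_left hm (by positivity : 0 ≤ c + σ * κ₁)
      linarith)
  have J2 := hα.qhJoin_midpoint hΩ hβ (p := 0 + c) (τ := T - 2 * c) (q := 0 + (c + σ))
    (τ' := T - 2 * c) (M := T - 2 * c)
    (by linarith) (by linarith) (by linarith) (by linarith) (by linarith) (by linarith)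
    (by linarith) (by
      intro u _ v _
      have hm := hΩ.add_boundaryDist_le (hα.mem u) (hβ.mem v)
      have h6 := mul_le_mul_of_nonneg_left hm (by linarith : 0 ≤ T - 2 * c)
      linarith)
  have hM3 : 0 < c - σ * κ₃ := by nlinarith
  have J3 := hα.qhJoin_midpoint hΩ hβ (p := 0 + c + (T - 2 * c)) (τ := c)
    (q := 0 + (c + σ) + (T - 2 * c)) (τ' := c - σ) (M := c - σ * κ₃)
    (by linarith) hc.le (by linarith) (by linarith) (by linarith) (by linarith) hM3 (by
      intro u hu v hv
      have huT : u ≤ T := by linarith [hu.2]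
      have hvT : v ≤ T := by linarith [hv.2]
      have hm := hΩ.add_boundaryDist_le (hα.mem u) (hβ.mem v)
      have h1 := hα.le_boundaryDist (by linarith [hu.1]) huT le_rfl
      have h2 := hβ.boundaryDist_le (by linarith [hv.1]) hvT le_rfl
      rw [hα1] at h1
      rw [hβ1] at h2
      have h3 : ρ ^ 3 * boundaryDist Ω (α u) ≤ boundaryDist Ω (β v) := by
        have h31 : ρ ^ 3 * boundaryDist Ω (α u) * Real.exp (T - v) ≤
            boundaryDist Ω (β v) * Real.exp (T - v) := by
          calc _ ≤ ρ ^ 3 * (boundaryDist Ω y * Real.exp (T - u)) * Real.exp (T - v) := by gcongr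
            _ = boundaryDist Ω y * Real.exp (12 * c + (T - u) + (T - v)) := by
              rw [hρ3, Real.exp_add, Real.exp_add]
              ring
            _ ≤ boundaryDist Ω y * Real.exp (16 * c) := mul_le_mul_of_nonneg_left
              (Real.exp_le_exp.2 (by linarith [hu.1, hv.1])) Metric.infDist_nonneg
            _ ≤ _ := hratio.trans h2
        exact le_of_mul_le_mul_right h31 (Real.exp_pos _)
      have h4 : κ₃ * (boundaryDist Ω (α u) + boundaryDist Ω (β v)) ≤ boundaryDist Ω (β v) := by
        rw [hκ₃, div_mul_eq_mul_div, div_le_iff₀ (by positivity)]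
        linarith
      have h5 := mul_le_mul_of_nonneg_left h4 hσ0.le
      have h6 := mul_le_mul_of_nonneg_left hm hM3.le
      linarith)
  have J := (J1.trans J2).trans J3
  rw [hα0, hβ0, midpoint_self, show 0 + c + (T - 2 * c) + c = T by ring,
    show 0 + (c + σ) + (T - 2 * c) + (c - σ) = T by ring, hα1, hβ1] at J
  refine ⟨_, ?_, J⟩
  linarith

/-- The concavity argument with a gain: the shifted points x + d(x) w and y + d(y) w are still at
least ε apart, since the shifts differ by at most |d(x) - d(y)|. So a δ-ball about their midpoint
lies in Ω, and the radius grows by δ. -/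
theorem IsConvexDomain.le_boundaryDist_midpoint (hΩ : IsConvexDomain Ω) {ε δ : ℝ}
    (huc : ∀ a ∈ Ω, ∀ b ∈ Ω, ε ≤ ‖a - b‖ → Metric.ball (midpoint ℝ a b) δ ⊆ Ω) (hδ : 0 < δ)
    (hx : x ∈ Ω) (hy : y ∈ Ω) (h : ε + |boundaryDist Ω x - boundaryDist Ω y| ≤ ‖x - y‖) :
    boundaryDist Ω x + boundaryDist Ω y + 2 * δ ≤ 2 * boundaryDist Ω (midpoint ℝ x y) := by
  have hdx := hΩ.boundaryDist_pos hx
  have hdy := hΩ.boundaryDist_pos hy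
  suffices (boundaryDist Ω x + boundaryDist Ω y) / 2 + δ ≤ boundaryDist Ω (midpoint ℝ x y) by
    linarith
  refine hΩ.le_boundaryDist fun p hp => ?_
  set R := (boundaryDist Ω x + boundaryDist Ω y) / 2 + δ with hR
  have hR0 : 0 < R := by positivity
  set w := R⁻¹ • (p - midpoint ℝ x y) with hw
  have hw1 : ‖w‖ < 1 := by
    rw [hw, norm_smul, norm_inv, Real.norm_of_nonneg hR0.le, inv_mul_lt_iff₀ hR0, mul_one,
      ← dist_eq_norm]
    exact hp
  have key : ∀ v ∈ Ω, v + boundaryDist Ω v • w ∈ Ω := by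
    intro v hv
    have hdv := hΩ.boundaryDist_pos hv
    apply hΩ.ball_subset hv
    rw [Metric.mem_ball, dist_eq_norm, add_sub_cancel_left, norm_smul, Real.norm_of_nonneg hdv.le]
    exact mul_lt_of_lt_one_right hdv hw1
  refine huc _ (key x hx) _ (key y hy) ?_ ?_
  · have h1 : (x + boundaryDist Ω x • w) - (y + boundaryDist Ω y • w) =
        (x - y) + (boundaryDist Ω x - boundaryDist Ω y) • w := by
      rw [sub_smul]
      abel
    have h2 : ‖(boundaryDist Ω x - boundaryDist Ω y) • w‖ ≤
        |boundaryDist Ω x - boundaryDist Ω y| := by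
      rw [norm_smul, Real.norm_eq_abs]
      exact mul_le_of_le_one_right (abs_nonneg _) hw1.le
    have h3 := norm_sub_le (x - y + (boundaryDist Ω x - boundaryDist Ω y) • w)
      ((boundaryDist Ω x - boundaryDist Ω y) • w)
    rw [add_sub_cancel_right] at h3
    rw [h1]
    linarith
  · have h1 : p = midpoint ℝ x y + R • w := by
      rw [hw, smul_inv_smul₀ hR0.ne', add_sub_cancel]
    have h2 : p - midpoint ℝ (x + boundaryDist Ω x • w) (y + boundaryDist Ω y • w) = δ • w := by
      rw [h1, hR, midpoint_eq_smul_add, midpoint_eq_smul_add, invOf_eq_inv]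
      module
    rw [Metric.mem_ball, dist_eq_norm, h2, norm_smul, Real.norm_of_nonneg hδ.le]
    exact mul_lt_of_lt_one_right hδ hw1

/-- During the last time c the paths stay within D/8 of y and z, so they are at least 3D/4 apart
while their boundary distances differ by at most D/4. Uniform convexity with ε = D/2 then shortens
this phase by a fixed factor. -/
theorem exists_qhJoin_midpoint_of_boundaryDist_eq (hΩ : IsConvexDomain Ω)
    (huc : IsUniformlyConvexSet Ω) (hr : 0 < r) (hy : ∀ T > r, QHJoin Ω T x y)
    (hz : ∀ T > r, QHJoin Ω T x z) (hne : y ≠ z) (hyz : boundaryDist Ω y = boundaryDist Ω z) :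
    ∃ T < r, QHJoin Ω T x (midpoint ℝ y z) := by
  set A := boundaryDist Ω y with hA
  have hA0 : 0 < A := hΩ.boundaryDist_pos (hy (r + 1) (by simp)).mem_right
  set D := ‖y - z‖ with hD
  have hD0 : 0 < D := norm_pos_iff.2 (sub_ne_zero.2 hne)
  obtain ⟨δ, hδ, huc⟩ := huc (D / 2) (by positivity)
  obtain ⟨c, hc, hcr, hcD⟩ : ∃ c : ℝ, 0 < c ∧ 2 * c ≤ r ∧ A * (Real.exp c - 1) ≤ D / 8 := by
    have hlog : 0 < Real.log (1 + D / (8 * A)) := by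
      apply Real.log_pos
      have : 0 < D / (8 * A) := by positivity
      linarith
    refine ⟨min (r / 2) (Real.log (1 + D / (8 * A))), lt_min (by positivity) hlog, ?_, ?_⟩
    · linarith [min_le_left (r / 2) (Real.log (1 + D / (8 * A)))]
    · have := Real.exp_le_exp.2 (min_le_right (r / 2) (Real.log (1 + D / (8 * A))))
      rw [Real.exp_log (by positivity)] at this
      calc _ ≤ A * (D / (8 * A)) := mul_le_mul_of_nonneg_left (by linarith) hA0.le
        _ = D / 8 := by field_simp
  -- S bounds d on both final pieces, so (a + b) / (a + b + 2δ) ≤ S / (S + δ).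
  set S := A + D / 8 with hS
  have hS0 : 0 < S := by positivity
  have hgain : c * (S / (S + δ)) < c :=
    mul_lt_of_lt_one_right hc ((div_lt_one (by positivity)).2 (by linarith))
  set T := r + (c - c * (S / (S + δ))) / 2 with hT
  have hTr : r < T := by linarith
  have near : ∀ {α : ℝ → X}, IsQHPath Ω α T → boundaryDist Ω (α T) = A → ∀ u, T - c ≤ u →
      u ≤ T → ‖α u - α T‖ ≤ D / 8 := by
    intro α hα hA' u hu huT
    have h1 := hα.reverse.norm_sub_le (s := 0) (t := T - u) le_rfl (by linarith) (by linarith)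
    simp only [sub_sub_cancel, sub_zero, hA'] at h1
    refine h1.trans (le_trans ?_ hcD)
    have := Real.exp_le_exp.2 (by linarith : T - u ≤ c)
    exact mul_le_mul_of_nonneg_left (by linarith) hA0.le
  obtain ⟨-, α, hα, hα0, hα1⟩ := hy T hTr
  obtain ⟨-, β, hβ, hβ0, hβ1⟩ := hz T hTr
  have J1 := hα.qhJoin_midpoint hΩ hβ (p := 0) (τ := T - c) (q := 0) (τ' := T - c) (M := T - c)
    le_rfl (by linarith) (by linarith) le_rfl (by linarith) (by linarith) (by linarith) (by
      intro u _ v _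
      have hm := hΩ.add_boundaryDist_le (hα.mem u) (hβ.mem v)
      have h6 := mul_le_mul_of_nonneg_left hm (by linarith : 0 ≤ T - c)
      linarith)
  have J2 := hα.qhJoin_midpoint hΩ hβ (p := 0 + (T - c)) (τ := c) (q := 0 + (T - c)) (τ' := c)
    (M := c * (S / (S + δ)))
    (by linarith) hc.le (by linarith) (by linarith) hc.le (by linarith) (by positivity) (by
      intro u hu v hv
      have h1 := near hα (by rw [hα1]) u (by linarith [hu.1]) (by linarith [hu.2])
      have h2 := near hβ (by rw [hβ1, hyz]) v (by linarith [hv.1]) (by linarith [hv.2])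
      rw [hα1] at h1
      rw [hβ1] at h2
      have h3 := abs_le.1 ((abs_boundaryDist_sub_le Ω (α u) y).trans h1)
      have h4 := abs_le.1 ((abs_boundaryDist_sub_le Ω (β v) z).trans h2)
      rw [← hA] at h3
      rw [← hyz] at h4
      have h5 : |boundaryDist Ω (α u) - boundaryDist Ω (β v)| ≤ D / 4 :=
        abs_le.2 ⟨by linarith, by linarith⟩
      have h6 : D ≤ ‖α u - β v‖ + D / 4 := by
        have e1 : y - z = (α u - β v) - (α u - y) + (β v - z) := by abel
        have e2 := norm_add_le ((α u - β v) - (α u - y)) (β v - z)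
        have e3 := norm_sub_le (α u - β v) (α u - y)
        rw [← e1] at e2
        linarith
      have hm := hΩ.le_boundaryDist_midpoint huc hδ (hα.mem u) (hβ.mem v) (by linarith)
      set a := boundaryDist Ω (α u)
      set b := boundaryDist Ω (β v)
      have h7 : a + b ≤ S / (S + δ) * (a + b + 2 * δ) := by
        rw [div_mul_eq_mul_div, le_div_iff₀ (by positivity)]
        nlinarith
      have h8 : S / (S + δ) * (a + b + 2 * δ) ≤
          S / (S + δ) * (2 * boundaryDist Ω (midpoint ℝ (α u) (β v))) :=
        mul_le_mul_of_nonneg_left hm (by positivity)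
      have h9 := mul_le_mul_of_nonneg_left (h7.trans h8) hc.le
      linarith)
  have J := J1.trans J2
  rw [hα0, hβ0, midpoint_self, show 0 + (T - c) + c = T by ring, hα1, hβ1] at J
  refine ⟨_, ?_, J⟩
  linarith

theorem strictConvex_closure_quasihyperbolicBall (hΩ : IsConvexDomain Ω)
    (huc : IsUniformlyConvexSet Ω) (hx : x ∈ Ω) (hr : 0 < r) :
    StrictConvex ℝ (closure (quasihyperbolicBall Ω x r)) := by
  refine (convex_quasihyperbolicBall hΩ hx r).closure.strictConvex_of_midpoint_mem_interior
    fun y hy z hz hyz => ?_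
  have hy' := fun T (hT : T > r) => qhJoin_of_mem_closure_quasihyperbolicBall hΩ hx hy hT
  have hz' := fun T (hT : T > r) => qhJoin_of_mem_closure_quasihyperbolicBall hΩ hx hz hT
  refine interior_mono subset_closure ?_
  rw [(isOpen_quasihyperbolicBall hΩ hx r).interior_eq, mem_quasihyperbolicBall_iff hΩ hx]
  rcases lt_trichotomy (boundaryDist Ω y) (boundaryDist Ω z) with h | h | h
  · exact exists_qhJoin_midpoint_of_boundaryDist_lt hΩ hx hr hy' hz' h
  · exact exists_qhJoin_midpoint_of_boundaryDist_eq hΩ huc hr hy' hz' hyz h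
  · rw [midpoint_comm]
    exact exists_qhJoin_midpoint_of_boundaryDist_lt hΩ hx hr hz' hy' h

end QuasihyperbolicBall

/-! ### Convexity and strict convexity of j-balls -/

section JBall

variable {X : Type*} [NormedAddCommGroup X] [NormedSpace ℝ X] {Ω : Set X} {x y z : X} {r : ℝ}

theorem mem_jBall_iff (hΩ : IsConvexDomain Ω) (hx : x ∈ Ω) :
    y ∈ jBall Ω x r ↔ y ∈ Ω ∧ ‖x - y‖ < (Real.exp r - 1) * boundaryDist Ω x ∧
      ‖x - y‖ < (Real.exp r - 1) * boundaryDist Ω y := by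
  refine and_congr_right fun hy => ?_
  have hdx := hΩ.boundaryDist_pos hx
  have hdy := hΩ.boundaryDist_pos hy
  have hm : 0 < min (boundaryDist Ω x) (boundaryDist Ω y) := lt_min hdx hdy
  rw [distanceRatioDist, Real.log_lt_iff_lt_exp (by positivity), ← lt_sub_iff_add_lt',
    div_lt_iff₀ hm]
  -- The sign of exp r - 1 is not assumed: either strict inequality forces it to be positive.
  rcases min_choice (boundaryDist Ω x) (boundaryDist Ω y) with h | h
  · rw [h]
    have h1 := min_eq_left_iff.1 h
    refine ⟨fun h2 => ⟨h2, h2.trans_le (mul_le_mul_of_nonneg_left h1 ?_)⟩, fun h2 => h2.1⟩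
    exact (pos_of_mul_pos_left ((norm_nonneg _).trans_lt h2) hdx.le).le
  · rw [h]
    have h1 := min_eq_right_iff.1 h
    refine ⟨fun h2 => ⟨h2.trans_le (mul_le_mul_of_nonneg_left h1 ?_), h2⟩, fun h2 => h2.2⟩
    exact (pos_of_mul_pos_left ((norm_nonneg _).trans_lt h2) hdy.le).le

theorem norm_sub_combo_le {a b : ℝ} (ha : 0 ≤ a) (hb : 0 ≤ b) (hab : a + b = 1) :
    ‖x - (a • y + b • z)‖ ≤ a * ‖x - y‖ + b * ‖x - z‖ := by
  have h : x - (a • y + b • z) = a • (x - y) + b • (x - z) := by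
    nth_rewrite 1 [← one_smul ℝ x, ← hab]
    module
  rw [h]
  refine (norm_add_le _ _).trans_eq ?_
  rw [norm_smul, norm_smul, Real.norm_of_nonneg ha, Real.norm_of_nonneg hb]

theorem convex_jBall (hΩ : IsConvexDomain Ω) (hx : x ∈ Ω) (hr : 0 < r) :
    Convex ℝ (jBall Ω x r) := by
  intro y hy z hz a b ha hb hab
  rw [mem_jBall_iff hΩ hx] at *
  have hR : 0 < Real.exp r - 1 := sub_pos.2 (Real.one_lt_exp_iff.2 hr)
  have hle := norm_sub_combo_le (x := x) (y := y) (z := z) ha hb hab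
  have hlt : ∀ {p q p' q' : ℝ}, p < p' → q < q' → a * p + b * q < a * p' + b * q' := by
    intro p q p' q' hp hq
    rcases ha.eq_or_lt with rfl | ha
    · have : b = 1 := by linarith
      simpa [this] using hq
    · exact add_lt_add_of_lt_of_le (mul_lt_mul_of_pos_left hp ha)
        (mul_le_mul_of_nonneg_left hq.le hb)
  refine ⟨hΩ.convex hy.1 hz.1 ha hb hab, ?_, ?_⟩
  · have := hle.trans_lt (hlt hy.2.1 hz.2.1)
    rwa [← add_mul, hab, one_mul] at this
  · have h1 := hΩ.concaveOn_boundaryDist.2 hy.1 hz.1 ha hb hab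
    simp only [smul_eq_mul] at h1
    have h2 := mul_le_mul_of_nonneg_left h1 hR.le
    have h3 := hle.trans_lt (hlt hy.2.2 hz.2.2)
    linarith

theorem isOpen_jBall (hΩ : IsConvexDomain Ω) (hx : x ∈ Ω) (r : ℝ) : IsOpen (jBall Ω x r) := by
  have h : jBall Ω x r = Ω ∩ ({y | ‖x - y‖ < (Real.exp r - 1) * boundaryDist Ω x} ∩
      {y | ‖x - y‖ < (Real.exp r - 1) * boundaryDist Ω y}) := by
    ext y
    exact mem_jBall_iff hΩ hx
  rw [h]
  have hd := Metric.continuous_infDist_pt (frontier Ω)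
  exact hΩ.isOpen.inter ((isOpen_lt (by fun_prop) continuous_const).inter
    (isOpen_lt (by fun_prop) (continuous_const.mul hd)))

theorem isBounded_jBall (hΩ : IsConvexDomain Ω) (hx : x ∈ Ω) (r : ℝ) :
    Bornology.IsBounded (jBall Ω x r) := by
  refine Metric.isBounded_closedBall.subset
    (t := Metric.closedBall x ((Real.exp r - 1) * boundaryDist Ω x)) fun y hy => ?_
  rw [Metric.mem_closedBall, dist_comm, dist_eq_norm]
  exact ((mem_jBall_iff hΩ hx).1 hy).2.1.le

theorem of_mem_closure_jBall (hΩ : IsConvexDomain Ω) (hx : x ∈ Ω) (hr : 0 < r)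
    (hy : y ∈ closure (jBall Ω x r)) :
    y ∈ Ω ∧ ‖x - y‖ ≤ (Real.exp r - 1) * boundaryDist Ω x ∧
      ‖x - y‖ ≤ (Real.exp r - 1) * boundaryDist Ω y := by
  have hR : 0 < Real.exp r - 1 := sub_pos.2 (Real.one_lt_exp_iff.2 hr)
  have hd := Metric.continuous_infDist_pt (frontier Ω)
  have h1 : ‖x - y‖ ≤ (Real.exp r - 1) * boundaryDist Ω x :=
    closure_minimal (fun z hz => ((mem_jBall_iff hΩ hx).1 hz).2.1.le)
      (isClosed_le (by fun_prop : Continuous fun z => ‖x - z‖) continuous_const) hy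
  have h2 : ‖x - y‖ ≤ (Real.exp r - 1) * boundaryDist Ω y :=
    closure_minimal (fun z hz => ((mem_jBall_iff hΩ hx).1 hz).2.2.le)
      (isClosed_le (by fun_prop : Continuous fun z => ‖x - z‖) (continuous_const.mul hd)) hy
  refine ⟨?_, h1, h2⟩
  -- For y ≠ x the second inequality forces d(y) > 0, so y is not on the boundary.
  rcases eq_or_ne x y with rfl | hxy
  · exact hx
  · have h3 : 0 < ‖x - y‖ := norm_pos_iff.2 (sub_ne_zero.2 hxy)
    exact hΩ.mem_of_mem_closure (closure_mono (fun z hz => hz.1) hy)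
      (pos_of_mul_pos_right (h3.trans_le h2) hR.le)

theorem midpoint_mem_jBall [StrictConvexSpace ℝ X] (hΩ : IsConvexDomain Ω) (hx : x ∈ Ω)
    (hr : 0 < r) (hy : y ∈ closure (jBall Ω x r)) (hz : z ∈ closure (jBall Ω x r)) (hyz : y ≠ z) :
    midpoint ℝ y z ∈ jBall Ω x r := by
  wlog hle : ‖x - y‖ ≤ ‖x - z‖ generalizing y z
  · rw [midpoint_comm]
    exact this hz hy hyz.symm (le_of_not_ge hle)
  have hR : 0 < Real.exp r - 1 := sub_pos.2 (Real.one_lt_exp_iff.2 hr)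
  obtain ⟨hyΩ, hy1, hy2⟩ := of_mem_closure_jBall hΩ hx hr hy
  obtain ⟨hzΩ, hz1, hz2⟩ := of_mem_closure_jBall hΩ hx hr hz
  have hmid : midpoint ℝ y z ∈ Ω := hΩ.convex.midpoint_mem hyΩ hzΩ
  have hsub : x - midpoint ℝ y z = (1 / 2 : ℝ) • (x - y) + (1 / 2 : ℝ) • (x - z) := by
    rw [midpoint_eq_smul_add, invOf_eq_inv]
    module
  have hne : x - y ≠ x - z := fun h => hyz (sub_right_injective h)
  refine (mem_jBall_iff hΩ hx).2 ⟨hmid, ?_, ?_⟩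
  · rw [hsub]
    exact norm_combo_lt_of_ne hy1 hz1 hne (by norm_num) (by norm_num) (by norm_num)
  -- On a common ray y lies between x and z, and so does the midpoint, with positive weight 1 - s on
  -- x. The inequality is strict at x, where it reads 0 < (exp r - 1) d(x), and concavity of d
  -- carries this over. Off a common ray the triangle inequality is strict.
  by_cases hray : SameRay ℝ (x - z) (x - y)
  · have hxz : x - z ≠ 0 := fun h => by
      rw [h, norm_zero] at hle
      exact hne ((norm_le_zero_iff.1 hle).trans h.symm)
    have hxz' : 0 < ‖x - z‖ := norm_pos_iff.2 hxz
    obtain ⟨t, ht, hteq⟩ := hray.exists_nonneg_left hxz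
    have ht1 : t < 1 := by
      rw [← hteq, norm_smul, Real.norm_of_nonneg ht] at hle
      refine lt_of_le_of_ne (by nlinarith) ?_
      rintro rfl
      exact hne (by rw [← hteq, one_smul])
    set s := (t + 1) / 2 with hs
    have hs1 : s < 1 := by linarith
    have hs0 : 0 ≤ s := by positivity
    have hsub' : x - midpoint ℝ y z = s • (x - z) := by
      rw [hsub, ← hteq, hs]
      module
    have hmid' : midpoint ℝ y z = (1 - s) • x + s • z := by
      rw [← sub_sub_cancel x (midpoint ℝ y z), hsub']
      module
    have hconc := hΩ.concaveOn_boundaryDist.2 hx hzΩ (sub_nonneg.2 hs1.le) hs0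
      (sub_add_cancel 1 s)
    rw [← hmid'] at hconc
    simp only [smul_eq_mul] at hconc
    have h1 := mul_le_mul_of_nonneg_left hconc hR.le
    have h2 : 0 < (Real.exp r - 1) * ((1 - s) * boundaryDist Ω x) :=
      mul_pos hR (mul_pos (sub_pos.2 hs1) (hΩ.boundaryDist_pos hx))
    have h3 := mul_le_mul_of_nonneg_left hz2 hs0
    rw [hsub', norm_smul, Real.norm_of_nonneg hs0]
    linarith
  · have h1 := norm_add_lt_of_not_sameRay hray
    have h2 := hΩ.add_boundaryDist_le hyΩ hzΩ
    have h3 := mul_le_mul_of_nonneg_left h2 hR.le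
    have h4 : ‖x - midpoint ℝ y z‖ = 1 / 2 * ‖(x - z) + (x - y)‖ := by
      rw [hsub, ← smul_add, norm_smul, add_comm (x - z)]
      norm_num
    rw [h4]
    linarith

theorem strictConvex_closure_jBall [StrictConvexSpace ℝ X] (hΩ : IsConvexDomain Ω) (hx : x ∈ Ω)
    (hr : 0 < r) : StrictConvex ℝ (closure (jBall Ω x r)) :=
  (convex_jBall hΩ hx hr).closure.strictConvex_of_midpoint_mem_interior fun _ hy _ hz hyz =>
    interior_mono subset_closure
      ((isOpen_jBall hΩ hx r).interior_eq.symm ▸ midpoint_mem_jBall hΩ hx hr hy hz hyz)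

end JBall

theorem mainTheorem2 {X : Type*} [NormedAddCommGroup X] [NormedSpace ℝ X] [CompleteSpace X]
    (Ω : Set X) (hopen : IsOpen Ω) (hne : Ω.Nonempty) (hconv : Convex ℝ Ω)
    (hproper : Ω ≠ Set.univ) :
    (∀ x ∈ Ω, ∀ r : ℝ, 0 < r →
      Convex ℝ (quasihyperbolicBall Ω x r) ∧ Convex ℝ (jBall Ω x r)) ∧
    ((IsUniformlyConvexSet Ω ∨ (StrictConvexSpace ℝ X ∧ HasRNP X)) →
      ∀ x ∈ Ω, ∀ r : ℝ, 0 < r →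
        IsStrictlyConvexOpen (quasihyperbolicBall Ω x r) ∧
        IsStrictlyConvexOpen (jBall Ω x r)) ∧
    (IsUniformlyConvexSet Ω → ∀ x ∈ Ω, ∀ r : ℝ, 0 < r →
      StrictConvex ℝ (closure (quasihyperbolicBall Ω x r))) ∧
    (StrictConvexSpace ℝ X → ∀ x ∈ Ω, ∀ r : ℝ, 0 < r →
      StrictConvex ℝ (closure (jBall Ω x r))) := by
  have hΩ : IsConvexDomain Ω := ⟨hopen, hne, hconv, hproper⟩
  refine ⟨fun x hx r hr => ⟨convex_quasihyperbolicBall hΩ hx r, convex_jBall hΩ hx hr⟩,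
    fun _ x hx r hr => ⟨?_, ?_⟩,
    fun huc x hx r hr => strictConvex_closure_quasihyperbolicBall hΩ huc hx hr,
    fun _ x hx r hr => strictConvex_closure_jBall hΩ hx hr⟩
  · exact .of_isBounded (convex_quasihyperbolicBall hΩ hx r) (isOpen_quasihyperbolicBall hΩ hx r)
      (isBounded_quasihyperbolicBall hΩ hx r)
  · exact .of_isBounded (convex_jBall hΩ hx hr) (isOpen_jBall hΩ hx r) (isBounded_jBall hΩ hx r)
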